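/- **Problem.** Let $1<\alpha\le 2$, $K_1,K_2\ge 0$ with $K_1^2+K_2^2\neq 0$, $x_L<x_R$, $T_f>0$, and let $u$ be an exact solution of $$\partial_t u=K_1\,{}_{x_L}D_x^{\alpha}u+K_2\,{}_xD_{x_R}^{\alpha}u+f\ \text{ in }(x_L,x_R)\times(0,T_f),\qquad u(x,0)=u_0(x),\quad u(x_L,t)=\phi_L(t),\quad u(x_R,t)=\phi_R(t),$$ where ${}_{x_L}D_x^{\alpha}v=D^2\,{}_{x_L}D_x^{-(2-\alpha)}v$ and ${}_xD_{x_R}^{\alpha}v=D^2\,{}_xD_{x_R}^{-(2-\alpha)}v$ are the left and right Riemann–Liouville derivatives, ${}_aD_x^{-\gamma}v(x)=\frac1{\Gamma(\gamma)}\int_a^x(x-\xi)^{\gamma-1}v(\xi)\,d\xi$, ${}_xD_b^{-\gamma}v(x)=\frac1{\Gamma(\gamma)}\int_x^b(\xi-x)^{\gamma-1}v(\xi)\,d\xi$ for $\gamma>0$, and the integral of order $0$ is the identity. **Order of the approximation.** Let $m\ge 1$ and let $c_{-1},c_0,c_1,d_{-1},d_0,d_1$ be real numbers. A function $v$ on $[a,b]$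 is called *left regular* if $v\in C^{m+1}[a,b]$, $v^{(k)}(a)=0$ for $0\le k\le m+1$, and ${}_aD_x^{-(2-\alpha)}v\in C^{m+2}[a,b]$, that is, ${}_aD_x^{\alpha+m}v$ exists and is continuous on $[a,b]$; *right regular* is the mirror image (vanishing at $b$, right integral). Put $g_k=(-1)^k\binom{\alpha}{k}$ and $\delta_{h,p}v(x)=h^{-\alpha}\sum_{k\ge0}g_k\,v(x-(k-p)h)$, with $v$ extended by zero outside $[a,b]$. The coefficients are *of $m$-th order* on $[a,b]$ if for every left regular $v$, as $h\to0$, uniformly in $x$ with $x\pm h\in[a,b]$, $$c_{-1}\,{}_aD_x^\alpha v(x-h)+c_0\,{}_aD_x^\alpha v(x)+c_1\,{}_aD_x^\alpha v(x+h)=d_{-1}\delta_{h,-1}v(x)+d_0\delta_{h,0}v(x)+d_1\delta_{h,1}v(x)+O(h^m).$$ (The derivatives are one-sided at the end points; the constant in $O(h^m)$ may depend on $v$.) **Scheme.** Let $h=(x_R-x_L)/N$, $\tau=T_f/M$, $x_i=x_L+ih$, $t_n=n\tau$, $t_{n+1/2}=(t_n+t_{n+1})/2$; $w_0=d_1g_0$,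 $w_1=d_0g_0+d_1g_1$, $w_k=d_{-1}g_{k-2}+d_0g_{k-1}+d_1g_k$ for $k\ge2$. Let $\mathbf T=\mathbf T_N$ be the tridiagonal Toeplitz matrix of order $N-1$ with $c_{-1},c_0,c_1$ on the sub-, main and superdiagonal, and $\mathbf A=\mathbf A_N$ the Toeplitz matrix of order $N-1$ with $\mathbf A_{ij}=w_{i-j+1}$ for $j\le i+1$ and $\mathbf A_{ij}=0$ otherwise. The CN-quasi-compact scheme is $$\Big(\mathbf T-\tfrac{\tau}{2h^\alpha}(K_1\mathbf A+K_2\mathbf A^{T})\Big)\mathbf U^{n+1}=\Big(\mathbf T+\tfrac{\tau}{2h^\alpha}(K_1\mathbf A+K_2\mathbf A^{T})\Big)\mathbf U^{n}+\tau\mathbf F^n+\mathbf H^n,\qquad 0\le n<M,$$ for $\mathbf U^n=(U_1^n,\dots,U_{N-1}^n)^T$, with $U_i^0=u_0(x_i)$ for $1\le i\le N-1$, $U_0^n=\phi_L(t_n)$, $U_N^n=\phi_R(t_n)$, $\mathbf F^n_i=c_{-1}f(x_{i-1},t_{n+1/2})+c_0f(x_i,t_{n+1/2})+c_1f(x_{i+1},t_{n+1/2})$,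 and $$\begin{aligned}\mathbf H^n_i={}&c_{-1}[i=1](U_0^n-U_0^{n+1})+c_1[i=N-1](U_N^n-U_N^{n+1})\\&+\tfrac{\tau}{2h^\alpha}\big(K_1w_{i+1}+K_2w_0[i=1]\big)(U_0^n+U_0^{n+1})+\tfrac{\tau}{2h^\alpha}\big(K_2w_{N-i+1}+K_1w_0[i=N-1]\big)(U_N^n+U_N^{n+1}),\end{aligned}$$ where $[P]$ is $1$ if $P$ holds and $0$ otherwise. **Theorem.** Assume that - the coefficients are of $m$-th order on $[x_L,x_R]$; - $u,\partial_tu,\partial_t^2u,\partial_t^3u$ and $f,\partial_tf,\partial_t^2f$ exist and are continuous on $[x_L,x_R]\times[0,T_f]$; - if $K_1\ne0$, then $u(\cdot,t)$ is left regular on $[x_L,x_R]$ for every $t\in[0,T_f]$, and ${}_{x_L}D_x^{\alpha+m}u$ is bounded on $[x_L,x_R]\times[0,T_f]$; if $K_2\neq0$, then $u(\cdot,t)$ is right regular for every $t\in[0,T_f]$, and ${}_xD_{x_R}^{\alpha+m}u$ is bounded on $[x_L,x_R]\times[0,T_f]$; - $\mathbf T_N$ is symmetric for every $N$ and strictly positive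 definite, uniformly in $N$: there is $\lambda>0$ with $v^T\mathbf T_Nv\ge\lambda\,v^Tv$ for all $N$ and all $v\in\mathbb R^{N-1}$. Then there is a constant $C$, independent of $N$, $M$, $n$ and $U$, such that for all $N,M\ge1$ for which $\mathbf A_N$ is negative definite ($v^T\mathbf A_Nv<0$ for all $v\ne0$), and every solution $U$ of the scheme, $$\|u^n-U^n\|\le C(\tau^2+h^m),\qquad 1\le n\le M,$$ where $\|u^n-U^n\|=\big(h\sum_{i=1}^{N-1}(u(x_i,t_n)-U_i^n)^2\big)^{1/2}$ is the discrete $L^2$ norm. -/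

import Mathlib

open Set

/-! ### Riemann-Liouville integrals and derivatives on a bounded interval `[a, b]` -/

/-- Left Riemann-Liouville integral of order `γ ≥ 0` with base point `a` (order `0` is the
identity). -/
noncomputable def leftFracInt (a γ : ℝ) (f : ℝ → ℝ) (x : ℝ) : ℝ :=
  if γ = 0 then f x else (1 / Real.Gamma γ) * ∫ ξ in a..x, (x - ξ) ^ (γ - 1) * f ξ

/-- Right Riemann-Liouville integral of order `γ ≥ 0` with base point `b` (order `0` is the
identity). -/
noncomputable def rightFracInt (b γ : ℝ) (f : ℝ → ℝ) (x : ℝ) : ℝ :=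
  if γ = 0 then f x else (1 / Real.Gamma γ) * ∫ ξ in x..b, (ξ - x) ^ (γ - 1) * f ξ

/-- Left Riemann-Liouville derivative of order `α` of a function on `[a, b]`; the classical
derivative of order `⌈α⌉` is one-sided at the two end points. -/
noncomputable def leftRL (a b α : ℝ) (f : ℝ → ℝ) (x : ℝ) : ℝ :=
  iteratedDerivWithin ⌈α⌉₊ (leftFracInt a ((⌈α⌉₊ : ℝ) - α) f) (Icc a b) x

/-- Right Riemann-Liouville derivative of order `α` of a function on `[a, b]`. -/
noncomputable def rightRL (a b α : ℝ) (f : ℝ → ℝ) (x : ℝ) : ℝ :=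
  (-1) ^ ⌈α⌉₊ * iteratedDerivWithin ⌈α⌉₊ (rightFracInt b ((⌈α⌉₊ : ℝ) - α) f) (Icc a b) x

/-! ### Shifted Grünwald differences and quasi-compact approximations -/

/-- The coefficients `(-1)^k (α choose k)` of the power series of `(1 - ζ)^α`. -/
noncomputable def grunwaldCoeff (α : ℝ) : ℕ → ℝ
  | 0 => 1
  | k + 1 => (1 - (α + 1) / ((k : ℝ) + 1)) * grunwaldCoeff α k

/-- The left Grünwald difference with shift `p` and step `h`, applied to the extension by zero of
a function on `[a, b]` (for `h > 0` only finitely many terms of the series are nonzero). -/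
noncomputable def leftGrunwald (a b α h : ℝ) (p : ℤ) (f : ℝ → ℝ) (x : ℝ) : ℝ :=
  (1 / h ^ α) * ∑' k : ℕ, grunwaldCoeff α k * (Icc a b).indicator f (x - ((k : ℝ) - (p : ℝ)) * h)

/-- The coefficients of a quasi-compact approximation: `cm, c0, c1` weight the fractional
derivative at `x - h, x, x + h`, and `dm, d0, d1` weight the Grünwald differences with shifts
`-1, 0, 1`. They do not depend on the step `h`. -/
structure QuasiCompact where
  cm : ℝ
  c0 : ℝ
  c1 : ℝ
  dm : ℝ
  d0 : ℝ
  d1 : ℝ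

/-- Spatial regularity at order `m` for the left derivative (`1 < α ≤ 2`): `f ∈ C^{m+1}[a, b]`,
`f^{(k)}(a) = 0` for `0 ≤ k ≤ m + 1`, and the left Riemann-Liouville derivative of order `α + m`,
i.e. the derivative of order `m + 2` of the integral of order `2 - α`, exists and is continuous on
`[a, b]`. -/
structure LeftRegular (α : ℝ) (m : ℕ) (a b : ℝ) (f : ℝ → ℝ) : Prop where
  smooth : ContDiffOn ℝ ((m + 1 : ℕ) : WithTop ℕ∞) f (Icc a b)
  vanish : ∀ k : ℕ, k ≤ m + 1 → iteratedDerivWithin k f (Icc a b) a = 0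
  frac : ContDiffOn ℝ ((m + 2 : ℕ) : WithTop ℕ∞) (leftFracInt a (2 - α) f) (Icc a b)

/-- The mirror image of `LeftRegular`. -/
structure RightRegular (α : ℝ) (m : ℕ) (a b : ℝ) (f : ℝ → ℝ) : Prop where
  smooth : ContDiffOn ℝ ((m + 1 : ℕ) : WithTop ℕ∞) f (Icc a b)
  vanish : ∀ k : ℕ, k ≤ m + 1 → iteratedDerivWithin k f (Icc a b) b = 0
  frac : ContDiffOn ℝ ((m + 2 : ℕ) : WithTop ℕ∞) (rightFracInt b (2 - α) f) (Icc a b)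

/-- The quasi-compact approximation is of `m`-th order on `[a, b]`: for every regular function,
`cm D^α f(x-h) + c0 D^α f(x) + c1 D^α f(x+h)
  = dm δ_{h,-1} f(x) + d0 δ_{h,0} f(x) + d1 δ_{h,1} f(x) + O(h^m)`,
uniformly in `x` with `x - h, x + h ∈ [a, b]`. -/
def QuasiCompact.HasOrder (q : QuasiCompact) (α : ℝ) (m : ℕ) (a b : ℝ) : Prop :=
  ∀ f : ℝ → ℝ, LeftRegular α m a b f →
    ∃ C : ℝ, ∀ h x : ℝ, 0 < h → a ≤ x - h → x + h ≤ b →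
      |q.cm * leftRL a b α f (x - h) + q.c0 * leftRL a b α f x + q.c1 * leftRL a b α f (x + h)
        - (q.dm * leftGrunwald a b α h (-1) f x + q.d0 * leftGrunwald a b α h 0 f x
            + q.d1 * leftGrunwald a b α h 1 f x)| ≤ C * h ^ m

/-! ### The Crank-Nicolson quasi-compact scheme -/

/-- The combined Grünwald weights `w_k`. -/
noncomputable def QuasiCompact.w (q : QuasiCompact) (α : ℝ) : ℕ → ℝ
  | 0 => q.d1 * grunwaldCoeff α 0
  | 1 => q.d0 * grunwaldCoeff α 0 + q.d1 * grunwaldCoeff α 1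
  | k + 2 => q.dm * grunwaldCoeff α k + q.d0 * grunwaldCoeff α (k + 1)
      + q.d1 * grunwaldCoeff α (k + 2)

/-- The tridiagonal Toeplitz matrix `T` of order `N - 1`. Here and below the index `i : Fin (N - 1)`
stands for the interior node number `i + 1`. -/
def QuasiCompact.matT (q : QuasiCompact) (N : ℕ) : Matrix (Fin (N - 1)) (Fin (N - 1)) ℝ :=
  fun i j =>
    if (j : ℕ) = i then q.c0
    else if (j : ℕ) = (i : ℕ) + 1 then q.c1
    else if (i : ℕ) = (j : ℕ) + 1 then q.cm
    else 0

/-- The Toeplitz matrix `A` of order `N - 1`, with entry `w_{i - j + 1}` for `j ≤ i + 1`, and `0`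
otherwise. -/
noncomputable def QuasiCompact.matA (q : QuasiCompact) (α : ℝ) (N : ℕ) :
    Matrix (Fin (N - 1)) (Fin (N - 1)) ℝ :=
  fun i j => if (j : ℕ) ≤ (i : ℕ) + 1 then q.w α ((i : ℕ) + 1 - (j : ℕ)) else 0

/-- A real square matrix, not necessarily symmetric, is negative definite. -/
def MatNegDef {n : ℕ} (A : Matrix (Fin n) (Fin n) ℝ) : Prop :=
  ∀ v : Fin n → ℝ, v ≠ 0 → v ⬝ᵥ A.mulVec v < 0

/-- The data of the two-sided space-fractional diffusion problem on `[xL, xR] × [0, Tf]`. -/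
structure DiffusionProblem where
  (α K₁ K₂ xL xR Tf : ℝ)
  f : ℝ → ℝ → ℝ
  u₀ : ℝ → ℝ
  φL : ℝ → ℝ
  φR : ℝ → ℝ
  one_lt_α : 1 < α
  α_le_two : α ≤ 2
  K₁_nonneg : 0 ≤ K₁
  K₂_nonneg : 0 ≤ K₂
  K_ne_zero : K₁ ^ 2 + K₂ ^ 2 ≠ 0
  xL_lt_xR : xL < xR
  Tf_pos : 0 < Tf

namespace DiffusionProblem

/-- Space step. -/
noncomputable def h (P : DiffusionProblem) (N : ℕ) : ℝ := (P.xR - P.xL) / N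

/-- Time step. -/
noncomputable def τ (P : DiffusionProblem) (M : ℕ) : ℝ := P.Tf / M

/-- Space nodes `x_i = xL + i h`. -/
noncomputable def x (P : DiffusionProblem) (N i : ℕ) : ℝ := P.xL + i * P.h N

/-- Time nodes `t_n = n τ`. -/
noncomputable def t (P : DiffusionProblem) (M n : ℕ) : ℝ := n * P.τ M

/-- `u` solves the initial-boundary value problem (`u x t` is the value at the point `x` and the
time `t`). -/
structure IsExactSolution (P : DiffusionProblem) (u : ℝ → ℝ → ℝ) : Prop where
  pde : ∀ x ∈ Ioo P.xL P.xR, ∀ t ∈ Ioo 0 P.Tf,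
    HasDerivAt (fun s => u x s)
      (P.K₁ * leftRL P.xL P.xR P.α (fun y => u y t) x
        + P.K₂ * rightRL P.xL P.xR P.α (fun y => u y t) x + P.f x t) t
  initial : ∀ x ∈ Icc P.xL P.xR, u x 0 = P.u₀ x
  left : ∀ t ∈ Icc 0 P.Tf, u P.xL t = P.φL t
  right : ∀ t ∈ Icc 0 P.Tf, u P.xR t = P.φR t

/-- `v` has continuous time derivatives up to order `k` on the closed rectangle. -/
def TimeSmooth (P : DiffusionProblem) (k : ℕ) (v : ℝ → ℝ → ℝ) : Prop :=
  (∀ x ∈ Icc P.xL P.xR, ContDiffOn ℝ (k : WithTop ℕ∞) (v x) (Icc 0 P.Tf)) ∧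
  ∀ j : ℕ, j ≤ k → ContinuousOn
    (fun z : ℝ × ℝ => iteratedDerivWithin j (v z.1) (Icc 0 P.Tf) z.2)
    (Icc P.xL P.xR ×ˢ Icc 0 P.Tf)

/-- The regularity of the exact solution that goes with an approximation of order `m` in space and
of order two in time. For each of the two fractional derivatives that is present in the equation,
`u(·, t)` is regular at order `m`, with the derivative of order `α + m` bounded uniformly in `t`. -/
structure IsRegular (P : DiffusionProblem) (m : ℕ) (u : ℝ → ℝ → ℝ) : Prop where
  time_u : P.TimeSmooth 3 u
  time_f : P.TimeSmooth 2 P.f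
  space_left : P.K₁ ≠ 0 →
    (∀ t ∈ Icc 0 P.Tf, LeftRegular P.α m P.xL P.xR (fun y => u y t)) ∧
    ∃ B : ℝ, ∀ t ∈ Icc 0 P.Tf, ∀ x ∈ Icc P.xL P.xR,
      |leftRL P.xL P.xR (P.α + m) (fun y => u y t) x| ≤ B
  space_right : P.K₂ ≠ 0 →
    (∀ t ∈ Icc 0 P.Tf, RightRegular P.α m P.xL P.xR (fun y => u y t)) ∧
    ∃ B : ℝ, ∀ t ∈ Icc 0 P.Tf, ∀ x ∈ Icc P.xL P.xR,
      |rightRL P.xL P.xR (P.α + m) (fun y => u y t) x| ≤ B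

/-- The vector of the interior values `v_1, …, v_{N-1}` of a grid function. -/
def interior (N : ℕ) (v : ℕ → ℝ) : Fin (N - 1) → ℝ := fun i => v ((i : ℕ) + 1)

/-- The discrete `L²` norm `(h ∑_{i=1}^{N-1} v_i²)^{1/2}`. -/
noncomputable def discreteL2 (P : DiffusionProblem) (N : ℕ) (v : Fin (N - 1) → ℝ) : ℝ :=
  Real.sqrt (P.h N * ∑ i, v i ^ 2)

/-- The matrix `τ / (2 h^α) (K₁ A + K₂ Aᵀ)`. -/
noncomputable def stiffness (P : DiffusionProblem) (q : QuasiCompact) (N M : ℕ) :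
    Matrix (Fin (N - 1)) (Fin (N - 1)) ℝ :=
  (P.τ M / (2 * P.h N ^ P.α)) •
    (P.K₁ • q.matA P.α N + P.K₂ • (q.matA P.α N).transpose)

/-- The source vector, with entries
`cm f(x_{i-1}, t_{n+1/2}) + c0 f(x_i, t_{n+1/2}) + c1 f(x_{i+1}, t_{n+1/2})`. -/
noncomputable def source (P : DiffusionProblem) (q : QuasiCompact) (N M n : ℕ) :
    Fin (N - 1) → ℝ :=
  fun i =>
    q.cm * P.f (P.x N i) ((P.t M n + P.t M (n + 1)) / 2)
      + q.c0 * P.f (P.x N ((i : ℕ) + 1)) ((P.t M n + P.t M (n + 1)) / 2)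
      + q.c1 * P.f (P.x N ((i : ℕ) + 2)) ((P.t M n + P.t M (n + 1)) / 2)

/-- The boundary vector, made of the contributions of the boundary values `U 0` and `U N` at the
time levels `n` and `n + 1`. -/
noncomputable def bdry (P : DiffusionProblem) (q : QuasiCompact) (N M : ℕ) (U : ℕ → ℕ → ℝ) (n : ℕ) :
    Fin (N - 1) → ℝ :=
  fun i =>
    (if (i : ℕ) + 1 = 1 then q.cm else 0) * (U 0 n - U 0 (n + 1))
      + (if (i : ℕ) + 1 = N - 1 then q.c1 else 0) * (U N n - U N (n + 1))
      + P.τ M / (2 * P.h N ^ P.α) *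
        ((P.K₁ * q.w P.α ((i : ℕ) + 2) + if (i : ℕ) + 1 = 1 then P.K₂ * q.w P.α 0 else 0)
            * (U 0 n + U 0 (n + 1))
          + (P.K₂ * q.w P.α (N - (i : ℕ)) + if (i : ℕ) + 1 = N - 1 then P.K₁ * q.w P.α 0 else 0)
            * (U N n + U N (n + 1)))

/-- `U` is a solution of the Crank-Nicolson quasi-compact scheme with `N` space steps and `M` time
steps (`U i n` is the value at the node `x_i` and the time `t_n`). -/
structure IsSchemeSolution (P : DiffusionProblem) (q : QuasiCompact) (N M : ℕ)
    (U : ℕ → ℕ → ℝ) : Prop where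
  initial : ∀ i : ℕ, 1 ≤ i → i < N → U i 0 = P.u₀ (P.x N i)
  left : ∀ n : ℕ, n ≤ M → U 0 n = P.φL (P.t M n)
  right : ∀ n : ℕ, n ≤ M → U N n = P.φR (P.t M n)
  step : ∀ n : ℕ, n < M →
    (q.matT N - P.stiffness q N M).mulVec (interior N (fun i => U i (n + 1)))
      = (q.matT N + P.stiffness q N M).mulVec (interior N (fun i => U i n))
        + P.τ M • P.source q N M n + P.bdry q N M U n

end DiffusionProblem

/-! The scheme has the form `(T - S) U^{n+1} = (T + S) U^n + data`, so the nodal error `e^n` obeys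
the same recursion with `e^0 = 0`, no boundary terms, and the defect `ρ^n` of the exact solution as
right-hand side. The proof is stability plus consistency.

Stability (`crankNicolson_energy`): pairing the recursion with `e^{n+1} + e^n` and using the
symmetry of `T` leaves the difference of the energies `e ⬝ T e` at two levels. The form of `S` is
nonpositive because `A` and its transpose have the same quadratic form. Hence the energy norm grows
per step by at most `‖ρ^n‖ / √λ`, and since `n τ ≤ Tf` it suffices that `ρ^n = O(τ (τ² + h^m))` at
every node.

Consistency in space: the order condition gives a constant depending on the function, while one
constant is needed for all `u(·, t)`. A left regular function is the integral of order `α + m` of a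
continuous `g`, its derivative of order `α + m` (`LeftRegular.eqOn_leftFracInt`), and every
continuous `g` arises (`leftFracInt_leftRegular`). For fixed `(h, x)` the defect is a continuous
linear functional of `g`. The order condition says that these functionals, divided by `h^m`, are
pointwise bounded, so Banach-Steinhaus bounds them by `C ‖g‖` (`HasOrder.exists_uniform`), and `‖g‖`
is bounded in `t` by assumption. The right derivative is handled by reflecting the interval, which
exchanges `cm` and `c1`; these agree because `T` is symmetric.

Consistency in time: the trapezoidal rule for `∂_t u` and the comparison of the average of `f` with
its midpoint value each contribute `O(τ³)` per step. The fractional terms are averaged over the two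
time levels, where the equation replaces them by `∂_t u - f` up to the spatial defect. -/

/-! ### Riemann-Liouville integrals: bounds, semigroup law, differentiation -/

theorem leftFracInt_zero (a : ℝ) (f : ℝ → ℝ) : leftFracInt a 0 f = f := by
  funext x; simp [leftFracInt]

theorem leftFracInt_one (a : ℝ) (f : ℝ → ℝ) (x : ℝ) :
    leftFracInt a 1 f x = ∫ ξ in a..x, f ξ := by
  simp [leftFracInt]

theorem leftFracInt_congr {a b γ : ℝ} {f g : ℝ → ℝ} (h : EqOn f g (Icc a b)) :
    EqOn (leftFracInt a γ f) (leftFracInt a γ g) (Icc a b) := by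
  intro x hx
  unfold leftFracInt
  split_ifs
  · exact h hx
  · congr 1
    refine intervalIntegral.integral_congr fun ξ hξ => ?_
    rw [uIcc_of_le hx.1] at hξ
    simp only [h ⟨hξ.1, hξ.2.trans hx.2⟩]

theorem leftFracInt_self {a γ : ℝ} (hγ : 0 < γ) (f : ℝ → ℝ) : leftFracInt a γ f a = 0 := by
  simp [leftFracInt, hγ.ne']

theorem intervalIntegrable_one_sub_rpow {γ : ℝ} (hγ : 0 < γ) :
    IntervalIntegrable (fun s : ℝ => (1 - s) ^ (γ - 1)) MeasureTheory.volume 0 1 := by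
  have := (intervalIntegral.intervalIntegrable_rpow' (r := γ - 1) (a := 1) (b := 0)
    (by linarith)).comp_sub_left 1
  simpa using this

/-- The integral of order `γ`, transported to the unit interval. -/
theorem leftFracInt_eq_unit {a γ x : ℝ} (hγ : 0 < γ) (hx : a ≤ x) (f : ℝ → ℝ) :
    leftFracInt a γ f x = (1 / Real.Gamma γ) *
      ((x - a) ^ γ * ∫ s in (0 : ℝ)..1, (1 - s) ^ (γ - 1) * f ((x - a) * s + a)) := by
  rw [leftFracInt, if_neg hγ.ne']
  congr 1
  rcases hx.eq_or_lt with rfl | hlt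
  · simp [Real.zero_rpow hγ.ne']
  have hpos : 0 < x - a := sub_pos.2 hlt
  have h1 := intervalIntegral.smul_integral_comp_mul_add
    (fun ξ => (x - ξ) ^ (γ - 1) * f ξ) (a := 0) (b := 1) (x - a) a
  simp only [mul_zero, zero_add, mul_one, sub_add_cancel, smul_eq_mul] at h1
  rw [← h1]
  have h2 : (x - a) ^ γ = (x - a) * (x - a) ^ (γ - 1) := by
    rw [Real.rpow_sub_one hpos.ne']; field_simp
  rw [h2, mul_assoc]
  congr 1
  rw [← intervalIntegral.integral_const_mul]
  refine intervalIntegral.integral_congr fun s hs => ?_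
  rw [uIcc_of_le zero_le_one] at hs
  have : x - ((x - a) * s + a) = (x - a) * (1 - s) := by ring
  simp only [this]
  rw [Real.mul_rpow hpos.le (by linarith [hs.2]), mul_assoc]

/-- On the unit interval the singular kernel no longer depends on `x`, so dominated convergence
applies with a multiple of the kernel as majorant. Global boundedness of `f` is what makes this
majorant independent of `x`. -/
theorem continuousOn_leftFracInt_of_bounded {a b γ M : ℝ} (hγ : 0 ≤ γ) {f : ℝ → ℝ}
    (hf : Continuous f) (hM : ∀ x, |f x| ≤ M) : ContinuousOn (leftFracInt a γ f) (Icc a b) := by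
  rcases hγ.eq_or_lt with rfl | hγ
  · rw [leftFracInt_zero]; exact hf.continuousOn
  have hc : Continuous fun x : ℝ =>
      ∫ s in (0 : ℝ)..1, (1 - s) ^ (γ - 1) * f ((x - a) * s + a) := by
    refine intervalIntegral.continuous_of_dominated_interval
      (bound := fun s => |(1 - s) ^ (γ - 1)| * M) (fun x => ?_) (fun x => ?_) ?_ ?_
    · exact ((intervalIntegrable_one_sub_rpow hγ).def'.aestronglyMeasurable).mul
        (by fun_prop)
    · refine Filter.Eventually.of_forall fun s _ => ?_
      rw [norm_mul, Real.norm_eq_abs, Real.norm_eq_abs]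
      exact mul_le_mul_of_nonneg_left (hM _) (abs_nonneg _)
    · exact (intervalIntegrable_one_sub_rpow hγ).abs.mul_const M
    · exact Filter.Eventually.of_forall fun s _ => by fun_prop
  have hp : Continuous fun x : ℝ => (x - a) ^ γ :=
    (continuous_id.sub continuous_const).rpow_const fun _ => Or.inr hγ.le
  refine ContinuousOn.congr (f := fun x => (1 / Real.Gamma γ) * ((x - a) ^ γ *
    ∫ s in (0 : ℝ)..1, (1 - s) ^ (γ - 1) * f ((x - a) * s + a))) ?_ ?_
  · exact (continuous_const.mul (hp.mul hc)).continuousOn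
  · exact fun x hx => leftFracInt_eq_unit hγ hx.1 f

/-- A continuous function on `[a, b]` has a bounded continuous extension to the line. -/
theorem exists_bounded_extension {a b : ℝ} (hab : a ≤ b) {f : ℝ → ℝ}
    (hf : ContinuousOn f (Icc a b)) :
    ∃ g : ℝ → ℝ, Continuous g ∧ EqOn f g (Icc a b) ∧ ∃ M, ∀ x, |g x| ≤ M := by
  refine ⟨IccExtend hab ((Icc a b).domRestrict f), ?_, ?_, ?_⟩
  · exact (continuousOn_iff_continuous_domRestrict.1 hf).Icc_extend'
  · intro x hx
    rw [IccExtend_of_mem hab _ hx]; rfl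
  · obtain ⟨M, hM⟩ := isCompact_Icc.exists_bound_of_continuousOn hf
    exact ⟨M, fun x => hM _ (projIcc a b hab x).2⟩

theorem continuousOn_leftFracInt {a b γ : ℝ} (hγ : 0 ≤ γ) {f : ℝ → ℝ}
    (hf : ContinuousOn f (Icc a b)) : ContinuousOn (leftFracInt a γ f) (Icc a b) := by
  rcases le_or_gt a b with hab | hab
  · obtain ⟨g, hg, hfg, M, hM⟩ := exists_bounded_extension hab hf
    exact (continuousOn_leftFracInt_of_bounded hγ hg hM).congr (leftFracInt_congr hfg)
  · simp [Icc_eq_empty_of_lt hab]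

/-- The constant precedes `f`: this is the operator bound in the sup norm that later makes
fractional integration a continuous functional. -/
theorem exists_leftFracInt_bound {a b γ : ℝ} (hγ : 0 ≤ γ) :
    ∃ K, ∀ (f : ℝ → ℝ) (M : ℝ), (∀ x ∈ Icc a b, |f x| ≤ M) →
      ∀ x ∈ Icc a b, |leftFracInt a γ f x| ≤ K * M := by
  rcases hγ.eq_or_lt with rfl | hγ
  · exact ⟨1, fun f M h x hx => by simpa [leftFracInt_zero] using h x hx⟩
  refine ⟨|1 / Real.Gamma γ| * ((b - a) ^ γ * ∫ s in (0 : ℝ)..1, |(1 - s) ^ (γ - 1)|),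
    fun f M h x hx => ?_⟩
  have hxa : 0 ≤ x - a := sub_nonneg.2 hx.1
  have hM : 0 ≤ M := (abs_nonneg _).trans (h x hx)
  rw [leftFracInt_eq_unit hγ hx.1, abs_mul, abs_mul, mul_assoc, mul_assoc]
  refine mul_le_mul_of_nonneg_left ?_ (abs_nonneg _)
  rw [abs_of_nonneg (Real.rpow_nonneg hxa γ)]
  refine mul_le_mul (Real.rpow_le_rpow hxa (by linarith [hx.2]) hγ.le) ?_ (abs_nonneg _)
    (Real.rpow_nonneg (by linarith [hx.2]) _)
  rw [← intervalIntegral.integral_mul_const]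
  rw [← Real.norm_eq_abs]
  refine intervalIntegral.norm_integral_le_of_norm_le zero_le_one
    (Filter.Eventually.of_forall fun s hs => ?_)
    ((intervalIntegrable_one_sub_rpow hγ).abs.mul_const M)
  rw [norm_mul]
  refine mul_le_mul_of_nonneg_left (h _ ⟨?_, ?_⟩) (norm_nonneg _)
  · have := mul_nonneg hxa hs.1.le
    linarith
  · have := mul_le_mul_of_nonneg_left hs.2 hxa
    linarith [hx.2]

theorem intervalIntegrable_leftKernel {a γ x : ℝ} (hγ : 0 < γ) (hx : a ≤ x) {f : ℝ → ℝ}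
    (hf : ContinuousOn f (Icc a x)) :
    IntervalIntegrable (fun ξ => (x - ξ) ^ (γ - 1) * f ξ) MeasureTheory.volume a x := by
  have := (intervalIntegral.intervalIntegrable_rpow' (r := γ - 1) (a := x - a) (b := 0)
    (by linarith)).comp_sub_left x
  simp only [sub_sub_cancel, sub_zero] at this
  exact this.mul_continuousOn (by rwa [uIcc_of_le hx])

theorem leftFracInt_add {a b γ : ℝ} (hγ : 0 ≤ γ) {f g : ℝ → ℝ} (hf : ContinuousOn f (Icc a b))
    (hg : ContinuousOn g (Icc a b)) {x : ℝ} (hx : x ∈ Icc a b) :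
    leftFracInt a γ (fun y => f y + g y) x = leftFracInt a γ f x + leftFracInt a γ g x := by
  rcases hγ.eq_or_lt with rfl | hγ
  · simp [leftFracInt]
  have hs : Icc a x ⊆ Icc a b := Icc_subset_Icc_right hx.2
  simp only [leftFracInt, if_neg hγ.ne']
  rw [← mul_add, ← intervalIntegral.integral_add
    (intervalIntegrable_leftKernel hγ hx.1 (hf.mono hs))
    (intervalIntegrable_leftKernel hγ hx.1 (hg.mono hs))]
  simp only [mul_add]

theorem leftFracInt_const_mul {a γ : ℝ} (c : ℝ) (f : ℝ → ℝ) (x : ℝ) :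
    leftFracInt a γ (fun y => c * f y) x = c * leftFracInt a γ f x := by
  unfold leftFracInt
  split_ifs
  · rfl
  · simp only [mul_left_comm _ c, intervalIntegral.integral_const_mul]

/-- Euler's integral of the first kind on `[s, x]`. -/
theorem integral_rpow_mul_rpow {s x β γ : ℝ} (hβ : 0 < β) (hγ : 0 < γ) (hsx : s < x) :
    ∫ ξ in s..x, (x - ξ) ^ (β - 1) * (ξ - s) ^ (γ - 1)
      = (x - s) ^ (β + γ - 1) * (Real.Gamma β * Real.Gamma γ / Real.Gamma (β + γ)) := by
  have hpos : 0 < x - s := sub_pos.2 hsx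
  have h0 := Complex.betaIntegral_scaled (γ : ℂ) (β : ℂ) hpos
  have hB : Complex.betaIntegral (γ : ℂ) (β : ℂ)
      = ((Real.Gamma β * Real.Gamma γ / Real.Gamma (β + γ) : ℝ) : ℂ) := by
    rw [Complex.betaIntegral_eq_Gamma_mul_div _ _ (by simpa) (by simpa), ← Complex.ofReal_add,
      Complex.Gamma_ofReal, Complex.Gamma_ofReal, Complex.Gamma_ofReal, add_comm γ β]
    push_cast
    ring
  have h1 : ∫ y in (0 : ℝ)..(x - s), (y : ℂ) ^ ((γ : ℂ) - 1) * (((x - s : ℝ) : ℂ) - y) ^ ((β : ℂ) - 1)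
      = ((∫ y in (0 : ℝ)..(x - s), y ^ (γ - 1) * (x - s - y) ^ (β - 1) : ℝ) : ℂ) := by
    rw [← intervalIntegral.integral_ofReal]
    refine intervalIntegral.integral_congr fun y hy => ?_
    rw [uIcc_of_le hpos.le] at hy
    rw [Complex.ofReal_mul, Complex.ofReal_cpow hy.1, Complex.ofReal_cpow (sub_nonneg.2 hy.2)]
    push_cast
    rfl
  rw [h1, hB, ← Complex.ofReal_one, ← Complex.ofReal_add, ← Complex.ofReal_sub,
    ← Complex.ofReal_cpow hpos.le, ← Complex.ofReal_mul] at h0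
  have h2 := Complex.ofReal_injective h0
  rw [show β + γ - 1 = γ + β - 1 by ring, ← h2]
  have h3 := intervalIntegral.integral_comp_sub_right
    (fun y => y ^ (γ - 1) * (x - s - y) ^ (β - 1)) s (a := s) (b := x)
  rw [sub_self] at h3
  rw [← h3]
  refine intervalIntegral.integral_congr fun y _ => ?_
  simp only [sub_sub_sub_cancel_right]
  ring

open MeasureTheory in
-- Fubini on the triangle `a < s ≤ ξ ≤ x`. Both kernels may be singular; integrability holds because
-- their product is the integrand of a convolution of two integrable truncated kernels, multiplied
-- by a bounded function.
theorem integral_leftKernel_swap {a x β γ M : ℝ} (hβ : 0 < β) (hγ : 0 < γ) (hx : a < x)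
    {f : ℝ → ℝ} (hf : Continuous f) (hM : ∀ y, |f y| ≤ M) :
    ∫ ξ in a..x, (x - ξ) ^ (β - 1) * ∫ s in a..ξ, (ξ - s) ^ (γ - 1) * f s
      = ∫ s in a..x, (∫ ξ in s..x, (x - ξ) ^ (β - 1) * (ξ - s) ^ (γ - 1)) * f s := by
  have hpos : 0 < x - a := sub_pos.2 hx
  set ψ : ℝ → ℝ := (Ioc a x).indicator fun ξ => (x - ξ) ^ (β - 1) with hψ
  -- Evaluated at `s - ξ`, the cutoff at `0` encodes `s ≤ ξ`; the cutoff at `a - x` is automatic for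
  -- `s, ξ ∈ (a, x]` and only serves integrability.
  set φ : ℝ → ℝ := (Ioc (a - x) 0).indicator fun y => (0 - y) ^ (γ - 1) with hφ
  set F : ℝ → ℝ := (Ioc a x).indicator f with hF
  have hψi : Integrable ψ := by
    rw [hψ, integrable_indicator_iff measurableSet_Ioc,
      ← intervalIntegrable_iff_integrableOn_Ioc_of_le hx.le]
    simpa using intervalIntegrable_leftKernel hβ hx.le (f := fun _ => 1) continuousOn_const
  have hφi : Integrable φ := by
    rw [hφ, integrable_indicator_iff measurableSet_Ioc,
      ← intervalIntegrable_iff_integrableOn_Ioc_of_le (by linarith)]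
    simpa using intervalIntegrable_leftKernel hγ (a := a - x) (x := 0) (by linarith)
      (f := fun _ => 1) continuousOn_const
  have hH : Integrable (fun p : ℝ × ℝ => ψ p.2 * φ (p.1 - p.2)) (volume.prod volume) :=
    hψi.convolution_integrand (ContinuousLinearMap.mul ℝ ℝ) hφi
  have hint : Integrable (fun p : ℝ × ℝ => F p.1 * (ψ p.2 * φ (p.1 - p.2)))
      (volume.prod volume) := by
    refine hH.bdd_mul (c := |M|)
      (((hf.measurable.indicator measurableSet_Ioc).comp measurable_fst).aestronglyMeasurable) ?_
    refine Filter.Eventually.of_forall fun p => ?_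
    simp only [hF, indicator]
    split_ifs
    · exact (hM _).trans (le_abs_self _)
    · simp
  have hswap := integral_integral_swap (f := fun s ξ => F s * (ψ ξ * φ (s - ξ))) hint
  have h1 : (fun ξ => ∫ s, F s * (ψ ξ * φ (s - ξ))) = (Ioc a x).indicator
      fun ξ => (x - ξ) ^ (β - 1) * ∫ s in a..ξ, (ξ - s) ^ (γ - 1) * f s := by
    funext ξ
    by_cases hξ : ξ ∈ Ioc a x
    · rw [indicator_of_mem hξ, ← intervalIntegral.integral_const_mul,
        intervalIntegral.integral_of_le hξ.1.le, ← integral_indicator measurableSet_Ioc]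
      congr 1
      funext s
      simp only [hF, hψ, hφ, indicator_of_mem hξ]
      by_cases hs : s ∈ Ioc a ξ
      · rw [indicator_of_mem hs, indicator_of_mem (show s ∈ Ioc a x from ⟨hs.1, hs.2.trans hξ.2⟩),
          indicator_of_mem (show s - ξ ∈ Ioc (a - x) 0 from
            ⟨by linarith [hs.1, hξ.2], by linarith [hs.2]⟩), show (0 : ℝ) - (s - ξ) = ξ - s by ring]
        ring
      · rw [indicator_of_notMem hs]
        by_cases hs' : a < s
        · rw [indicator_of_notMem (show s - ξ ∉ Ioc (a - x) 0 from
            fun h => hs ⟨hs', by linarith [h.2]⟩)]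
          simp
        · rw [indicator_of_notMem (show s ∉ Ioc a x from fun h => hs' h.1)]
          simp
    · rw [indicator_of_notMem hξ]
      simp [hψ, indicator_of_notMem hξ]
  have h2 : (fun s => ∫ ξ, F s * (ψ ξ * φ (s - ξ))) = (Ioc a x).indicator
      fun s => (∫ ξ in s..x, (x - ξ) ^ (β - 1) * (ξ - s) ^ (γ - 1)) * f s := by
    funext s
    by_cases hs : s ∈ Ioc a x
    · rw [indicator_of_mem hs, ← intervalIntegral.integral_mul_const,
        intervalIntegral.integral_of_le hs.2, integral_Ioc_eq_integral_Ioo,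
        ← integral_Icc_eq_integral_Ioo, ← integral_indicator measurableSet_Icc]
      congr 1
      funext ξ
      simp only [hF, hψ, hφ, indicator_of_mem hs]
      by_cases hξ : ξ ∈ Icc s x
      · rw [indicator_of_mem hξ, indicator_of_mem (show ξ ∈ Ioc a x from
            ⟨hs.1.trans_le hξ.1, hξ.2⟩),
          indicator_of_mem (show s - ξ ∈ Ioc (a - x) 0 from
            ⟨by linarith [hs.1, hξ.2], by linarith [hξ.1]⟩), show (0 : ℝ) - (s - ξ) = ξ - s by ring]
        ring
      · rw [indicator_of_notMem hξ]
        by_cases hξ' : ξ ≤ x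
        · rw [indicator_of_notMem (show s - ξ ∉ Ioc (a - x) 0 from
            fun h => hξ ⟨by linarith [h.2], hξ'⟩)]
          simp
        · rw [indicator_of_notMem (show ξ ∉ Ioc a x from fun h => hξ' h.2)]
          simp
    · rw [indicator_of_notMem hs]
      simp [hF, indicator_of_notMem hs]
  rw [h1, h2, integral_indicator measurableSet_Ioc, integral_indicator measurableSet_Ioc,
    ← intervalIntegral.integral_of_le hx.le, ← intervalIntegral.integral_of_le hx.le] at hswap
  exact hswap.symm

theorem leftFracInt_comp_of_bounded {a x β γ M : ℝ} (hβ : 0 < β) (hγ : 0 < γ) (hx : a < x)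
    {f : ℝ → ℝ} (hf : Continuous f) (hM : ∀ y, |f y| ≤ M) :
    leftFracInt a β (leftFracInt a γ f) x = leftFracInt a (β + γ) f x := by
  have h1 : leftFracInt a β (leftFracInt a γ f) x = 1 / Real.Gamma β * (1 / Real.Gamma γ *
      ∫ ξ in a..x, (x - ξ) ^ (β - 1) * ∫ s in a..ξ, (ξ - s) ^ (γ - 1) * f s) := by
    simp only [leftFracInt, if_neg hβ.ne', if_neg hγ.ne']
    congr 1
    rw [← intervalIntegral.integral_const_mul]
    exact intervalIntegral.integral_congr fun ξ _ => mul_left_comm _ _ _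
  rw [h1, integral_leftKernel_swap hβ hγ hx hf hM, leftFracInt, if_neg (by positivity)]
  have h2 : ∫ s in a..x, (∫ ξ in s..x, (x - ξ) ^ (β - 1) * (ξ - s) ^ (γ - 1)) * f s
      = ∫ s in a..x, (Real.Gamma β * Real.Gamma γ / Real.Gamma (β + γ)) *
        ((x - s) ^ (β + γ - 1) * f s) := by
    rw [intervalIntegral.integral_of_le hx.le, intervalIntegral.integral_of_le hx.le,
      MeasureTheory.integral_Ioc_eq_integral_Ioo, MeasureTheory.integral_Ioc_eq_integral_Ioo]
    refine MeasureTheory.setIntegral_congr_fun measurableSet_Ioo fun s hs => ?_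
    rw [integral_rpow_mul_rpow hβ hγ hs.2]
    ring
  rw [h2, intervalIntegral.integral_const_mul]
  have := (Real.Gamma_pos_of_pos hβ).ne'
  have := (Real.Gamma_pos_of_pos hγ).ne'
  field_simp

/-- The semigroup property of the Riemann-Liouville integrals. -/
theorem leftFracInt_comp {a b x β γ : ℝ} (hβ : 0 ≤ β) (hγ : 0 ≤ γ) {f : ℝ → ℝ}
    (hf : ContinuousOn f (Icc a b)) (hx : x ∈ Icc a b) :
    leftFracInt a β (leftFracInt a γ f) x = leftFracInt a (β + γ) f x := by
  rcases hβ.eq_or_lt with rfl | hβ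
  · rw [leftFracInt_zero, zero_add]
  rcases hγ.eq_or_lt with rfl | hγ
  · rw [leftFracInt_zero, add_zero]
  rcases hx.1.eq_or_lt with rfl | hlt
  · rw [leftFracInt_self hβ, leftFracInt_self (by positivity)]
  obtain ⟨g, hg, hfg, M, hM⟩ := exists_bounded_extension (hx.1.trans hx.2) hf
  rw [leftFracInt_congr (leftFracInt_congr hfg) hx, leftFracInt_congr hfg hx]
  exact leftFracInt_comp_of_bounded hβ hγ hlt hg hM

theorem hasDerivWithinAt_leftFracInt_one {a b : ℝ} (hab : a < b) {f : ℝ → ℝ}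
    (hf : ContinuousOn f (Icc a b)) {x : ℝ} (hx : x ∈ Icc a b) :
    HasDerivWithinAt (leftFracInt a 1 f) (f x) (Icc a b) x := by
  obtain ⟨g, hg, hfg, -⟩ := exists_bounded_extension hab.le hf
  rw [hfg hx]
  refine HasDerivWithinAt.congr_of_mem ?_ (leftFracInt_congr hfg) hx
  have h : HasDerivAt (fun y => ∫ ξ in a..y, g ξ) (g x) x :=
    (hg.integral_hasStrictDerivAt a x).hasDerivAt
  exact (h.congr_of_eventuallyEq
    (Filter.Eventually.of_forall fun y => leftFracInt_one a g y)).hasDerivWithinAt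

theorem hasDerivWithinAt_leftFracInt {a b γ : ℝ} (hab : a < b) (hγ : 0 ≤ γ) {f : ℝ → ℝ}
    (hf : ContinuousOn f (Icc a b)) {x : ℝ} (hx : x ∈ Icc a b) :
    HasDerivWithinAt (leftFracInt a (γ + 1) f) (leftFracInt a γ f x) (Icc a b) x := by
  refine (hasDerivWithinAt_leftFracInt_one hab (continuousOn_leftFracInt hγ hf) hx).congr_of_mem
    (fun y hy => ?_) hx
  rw [leftFracInt_comp zero_le_one hγ hf hy, add_comm]

theorem contDiffOn_leftFracInt {a b γ : ℝ} (hab : a < b) (hγ : 0 ≤ γ) {f : ℝ → ℝ}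
    (hf : ContinuousOn f (Icc a b)) (k : ℕ) :
    ContDiffOn ℝ (k : WithTop ℕ∞) (leftFracInt a (γ + k) f) (Icc a b) := by
  induction k with
  | zero => simpa using continuousOn_leftFracInt hγ hf
  | succ k ih =>
    have hd : ∀ x ∈ Icc a b, HasDerivWithinAt (leftFracInt a (γ + (k + 1 : ℕ)) f)
        (leftFracInt a (γ + k) f x) (Icc a b) x := fun x hx => by
      have := hasDerivWithinAt_leftFracInt (γ := γ + k) hab (by positivity) hf hx
      rwa [add_assoc, ← Nat.cast_succ] at this
    rw [Nat.cast_succ (R := WithTop ℕ∞), contDiffOn_succ_iff_derivWithin (uniqueDiffOn_Icc hab)]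
    refine ⟨fun x hx => (hd x hx).differentiableWithinAt, by simp, ih.congr fun x hx => ?_⟩
    exact (hd x hx).derivWithin (uniqueDiffOn_Icc hab x hx)

theorem iteratedDerivWithin_leftFracInt {a b γ : ℝ} (hab : a < b) (hγ : 0 ≤ γ) {f : ℝ → ℝ}
    (hf : ContinuousOn f (Icc a b)) (k : ℕ) {x : ℝ} (hx : x ∈ Icc a b) :
    iteratedDerivWithin k (leftFracInt a (γ + k) f) (Icc a b) x = leftFracInt a γ f x := by
  induction k with
  | zero => simp
  | succ k ih =>
    rw [iteratedDerivWithin_succ', ← ih]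
    refine iteratedDerivWithin_congr (fun y hy => ?_) hx
    have := hasDerivWithinAt_leftFracInt (γ := γ + k) hab (by positivity) hf hy
    rw [add_assoc, ← Nat.cast_succ] at this
    exact this.derivWithin (uniqueDiffOn_Icc hab y hy)

/-- Taylor's formula for functions vanishing to high order at the left end point. -/
theorem eqOn_leftFracInt_iteratedDerivWithin {a b : ℝ} (hab : a < b) (n : ℕ) {v : ℝ → ℝ}
    (hv : ContDiffOn ℝ (n : WithTop ℕ∞) v (Icc a b))
    (hva : ∀ k < n, iteratedDerivWithin k v (Icc a b) a = 0) :
    EqOn v (leftFracInt a n (iteratedDerivWithin n v (Icc a b))) (Icc a b) := by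
  induction n generalizing v with
  | zero => intro x _; simp [leftFracInt_zero]
  | succ n ih =>
    have hu := uniqueDiffOn_Icc hab
    have hc : ContinuousOn (iteratedDerivWithin (n + 1) v (Icc a b)) (Icc a b) :=
      hv.continuousOn_iteratedDerivWithin le_rfl hu
    have hv' := hv
    rw [Nat.cast_succ, contDiffOn_succ_iff_derivWithin hu] at hv'
    have h1 := ih hv'.2.2 fun k hk => by
      rw [← iteratedDerivWithin_succ']; exact hva _ (Nat.succ_lt_succ hk)
    rw [← iteratedDerivWithin_succ'] at h1
    have hd : ContinuousOn (derivWithin v (Icc a b)) (Icc a b) := hv'.2.2.continuousOn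
    intro x hx
    rw [Nat.cast_succ, add_comm, ← leftFracInt_comp zero_le_one n.cast_nonneg hc hx,
      ← leftFracInt_congr h1 hx, leftFracInt_one]
    have hsub : Icc a x ⊆ Icc a b := Icc_subset_Icc_right hx.2
    rw [intervalIntegral.integral_eq_sub_of_hasDerivAt_of_le hx.1 (hv.continuousOn.mono hsub)
      (fun y hy => ?_) ((hd.mono hsub).intervalIntegrable_of_Icc hx.1)]
    · have := hva 0 n.succ_pos
      rw [iteratedDerivWithin_zero] at this
      rw [this, sub_zero]
    · exact (hv'.1 y ⟨hy.1.le, hy.2.le.trans hx.2⟩).hasDerivWithinAt.hasDerivAt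
        (Icc_mem_nhds hy.1 (hy.2.trans_le hx.2))

/-! ### Riemann-Liouville derivatives and the representation of regular functions -/

theorem ceil_of_mem_Ioc {α : ℝ} (h1 : 1 < α) (h2 : α ≤ 2) : ⌈α⌉₊ = 2 := by
  rw [Nat.ceil_eq_iff two_ne_zero]; constructor <;> norm_num <;> assumption

theorem ceil_add_of_mem_Ioc {α : ℝ} (h1 : 1 < α) (h2 : α ≤ 2) (m : ℕ) : ⌈α + m⌉₊ = m + 2 := by
  rw [Nat.ceil_add_natCast (by linarith), ceil_of_mem_Ioc h1 h2, add_comm]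

theorem leftRL_eq {a b α : ℝ} (h1 : 1 < α) (h2 : α ≤ 2) (f : ℝ → ℝ) :
    leftRL a b α f = iteratedDerivWithin 2 (leftFracInt a (2 - α) f) (Icc a b) := by
  funext x
  simp [leftRL, ceil_of_mem_Ioc h1 h2]

theorem leftRL_add_eq {a b α : ℝ} (h1 : 1 < α) (h2 : α ≤ 2) (m : ℕ) (f : ℝ → ℝ) :
    leftRL a b (α + m) f = iteratedDerivWithin (m + 2) (leftFracInt a (2 - α) f) (Icc a b) := by
  funext x
  rw [leftRL, ceil_add_of_mem_Ioc h1 h2]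
  congr 2
  push_cast
  ring

/-- By this converse of the representation of regular functions, the order condition can be tested
on every continuous `g`, that is, on a whole Banach space. -/
theorem leftFracInt_leftRegular {a b α : ℝ} {m : ℕ} (hab : a < b) (h1 : 1 < α) (h2 : α ≤ 2)
    {g : ℝ → ℝ} (hg : ContinuousOn g (Icc a b)) :
    LeftRegular α m a b (leftFracInt a (α + m) g) := by
  have hfrac : EqOn (leftFracInt a (2 - α) (leftFracInt a (α + m) g))
      (leftFracInt a (0 + (m + 2 : ℕ)) g) (Icc a b) := fun x hx => by
    rw [leftFracInt_comp (by linarith) (by positivity) hg hx]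
    congr 1; push_cast; ring
  refine ⟨?_, fun k hk => ?_, ?_⟩
  · have := contDiffOn_leftFracInt (γ := α - 1) hab (by linarith) hg (m + 1)
    rwa [show α - 1 + ((m + 1 : ℕ) : ℝ) = α + m by push_cast; ring] at this
  · have hk' : (k : ℝ) ≤ m + 1 := by exact_mod_cast hk
    have := iteratedDerivWithin_leftFracInt (γ := α + m - k) hab (by linarith) hg k
      (left_mem_Icc.2 hab.le)
    rw [sub_add_cancel] at this
    rw [this, leftFracInt_self (by linarith)]
  · exact (contDiffOn_leftFracInt hab le_rfl hg (m + 2)).congr hfrac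

theorem leftRL_leftFracInt {a b α : ℝ} {m : ℕ} (hab : a < b) (h1 : 1 < α) (h2 : α ≤ 2)
    {g : ℝ → ℝ} (hg : ContinuousOn g (Icc a b)) {x : ℝ} (hx : x ∈ Icc a b) :
    leftRL a b α (leftFracInt a (α + m) g) x = leftFracInt a m g x := by
  rw [leftRL_eq h1 h2, ← iteratedDerivWithin_leftFracInt hab m.cast_nonneg hg 2 hx]
  refine iteratedDerivWithin_congr (fun y hy => ?_) hx
  rw [leftFracInt_comp (by linarith) (by positivity) hg hy]
  congr 1; push_cast; ring

theorem leftRL_congr {a b α : ℝ} {f g : ℝ → ℝ} (h : EqOn f g (Icc a b)) :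
    EqOn (leftRL a b α f) (leftRL a b α g) (Icc a b) := fun _ hx =>
  iteratedDerivWithin_congr (leftFracInt_congr h) hx

theorem LeftRegular.continuousOn_leftRL_add {a b α : ℝ} {m : ℕ} (hab : a < b) (h1 : 1 < α)
    (h2 : α ≤ 2) {f : ℝ → ℝ} (hf : LeftRegular α m a b f) :
    ContinuousOn (leftRL a b (α + m) f) (Icc a b) := by
  rw [leftRL_add_eq h1 h2]
  exact hf.frac.continuousOn_iteratedDerivWithin le_rfl (uniqueDiffOn_Icc hab)

theorem LeftRegular.continuousOn_leftRL {a b α : ℝ} {m : ℕ} (hab : a < b) (h1 : 1 < α)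
    (h2 : α ≤ 2) {f : ℝ → ℝ} (hf : LeftRegular α m a b f) :
    ContinuousOn (leftRL a b α f) (Icc a b) := by
  rw [leftRL_eq h1 h2]
  exact hf.frac.continuousOn_iteratedDerivWithin (by exact_mod_cast Nat.le_add_left 2 m)
    (uniqueDiffOn_Icc hab)

/-- A left regular function is the integral of order `α + m` of its derivative of order
`α + m`. -/
theorem LeftRegular.eqOn_leftFracInt {a b α : ℝ} {m : ℕ} (hab : a < b) (h1 : 1 < α)
    (h2 : α ≤ 2) {f : ℝ → ℝ} (hf : LeftRegular α m a b f) :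
    EqOn f (leftFracInt a (α + m) (leftRL a b (α + m) f)) (Icc a b) := by
  have hu := uniqueDiffOn_Icc hab
  have hg := hf.continuousOn_leftRL_add hab h1 h2
  set g := leftRL a b (α + m) f with hgdef
  set φ := iteratedDerivWithin (m + 1) f (Icc a b) with hφdef
  have hφ : ContinuousOn φ (Icc a b) := hf.smooth.continuousOn_iteratedDerivWithin le_rfl hu
  have hfφ := eqOn_leftFracInt_iteratedDerivWithin hab (m + 1) hf.smooth
    fun k hk => hf.vanish k hk.le
  have hfrac : EqOn (leftFracInt a (2 - α) f) (leftFracInt a (2 - α + (m + 1 : ℕ)) φ)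
      (Icc a b) := fun x hx => by
    rw [leftFracInt_congr hfφ hx, leftFracInt_comp (by linarith) (Nat.cast_nonneg _) hφ hx]
  have hva : ∀ k < m + 2, iteratedDerivWithin k (leftFracInt a (2 - α) f) (Icc a b) a = 0 := by
    intro k hk
    have ha : a ∈ Icc a b := left_mem_Icc.2 hab.le
    rw [iteratedDerivWithin_congr hfrac ha]
    have hk' : (k : ℝ) ≤ m + 1 := by exact_mod_cast Nat.lt_succ_iff.1 hk
    have h0 : 0 ≤ 2 - α + (m + 1 : ℕ) - k := by push_cast; linarith
    have := iteratedDerivWithin_leftFracInt hab h0 hφ k ha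
    rw [sub_add_cancel] at this
    rw [this]
    -- The remaining order is zero exactly when `α = 2` and `k = m + 1`; then the integral is `φ`
    -- itself, and the top vanishing condition on `f` is needed.
    rcases h0.eq_or_lt with h | h
    · rw [← h, leftFracInt_zero]
      exact hf.vanish _ le_rfl
    · exact leftFracInt_self h _
  have hv := eqOn_leftFracInt_iteratedDerivWithin hab (m + 2) hf.frac hva
  rw [← leftRL_add_eq h1 h2, ← hgdef] at hv
  -- Applying the integral of order `α - 1` to `I^{2-α} f = I^{m+2} g` gives `I^1 f = I^1 I^{α+m}
  -- g`; differentiating once then removes `I^1`.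
  have hI : EqOn (leftFracInt a 1 f) (leftFracInt a 1 (leftFracInt a (α + m) g)) (Icc a b) :=
    fun x hx => by
    rw [leftFracInt_comp zero_le_one (by positivity) hg hx]
    have e1 := leftFracInt_comp (β := α - 1) (γ := 2 - α) (by linarith) (by linarith)
      hf.smooth.continuousOn hx
    rw [leftFracInt_congr hv hx, leftFracInt_comp (by linarith) (Nat.cast_nonneg _) hg hx] at e1
    convert e1.symm using 2
    · ring
    · push_cast; ring
  intro x hx
  have d1 := hasDerivWithinAt_leftFracInt_one hab hf.smooth.continuousOn hx
  have d2 := hasDerivWithinAt_leftFracInt_one hab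
    (continuousOn_leftFracInt (γ := α + m) (by positivity) hg) hx
  exact (hu x hx).eq_deriv _ d1 (d2.congr_of_mem hI hx)

/-! ### A uniform constant in the order condition -/

theorem leftGrunwald_eq_sum {a b α h : ℝ} {p : ℤ} {f : ℝ → ℝ} {x : ℝ} {n : ℕ} (hh : 0 < h)
    (hn : x - ((n : ℝ) - p) * h < a) :
    leftGrunwald a b α h p f x = (1 / h ^ α) * ∑ k ∈ Finset.range n,
      grunwaldCoeff α k * (Icc a b).indicator f (x - ((k : ℝ) - p) * h) := by
  rw [leftGrunwald, tsum_eq_sum]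
  intro k hk
  rw [Finset.mem_range, not_lt] at hk
  have : (n : ℝ) * h ≤ k * h := mul_le_mul_of_nonneg_right (by exact_mod_cast hk) hh.le
  rw [indicator_of_notMem fun hm => by nlinarith [hm.1], mul_zero]

/-- Integration of fractional order followed by evaluation, as a continuous functional. -/
theorem exists_leftFracInt_clm {a b γ : ℝ} (hab : a ≤ b) (hγ : 0 ≤ γ) (y : ℝ) :
    ∃ J : C(Icc a b, ℝ) →L[ℝ] ℝ, ∀ g : C(Icc a b, ℝ),
      J g = (Icc a b).indicator (leftFracInt a γ (IccExtend hab g)) y := by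
  by_cases hy : y ∈ Icc a b
  · obtain ⟨K, hK⟩ := exists_leftFracInt_bound (a := a) (b := b) hγ
    have hc (g : C(Icc a b, ℝ)) : ContinuousOn (IccExtend hab g) (Icc a b) :=
      g.continuous.Icc_extend'.continuousOn
    refine ⟨LinearMap.mkContinuous
      { toFun := fun g => leftFracInt a γ (IccExtend hab g) y
        map_add' := fun g g' => leftFracInt_add hγ (hc g) (hc g') hy
        map_smul' := fun c g => leftFracInt_const_mul c (IccExtend hab g) y } K
      fun g => hK _ _ (fun x _ => g.norm_coe_le_norm _) y hy, fun g => ?_⟩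
    rw [indicator_of_mem hy]
    rfl
  · exact ⟨0, fun g => by rw [indicator_of_notMem hy]; rfl⟩

/-- The defect of a quasi-compact approximation. -/
noncomputable def QuasiCompact.defect (q : QuasiCompact) (α a b h : ℝ) (f : ℝ → ℝ) (x : ℝ) : ℝ :=
  q.cm * leftRL a b α f (x - h) + q.c0 * leftRL a b α f x + q.c1 * leftRL a b α f (x + h)
    - (q.dm * leftGrunwald a b α h (-1) f x + q.d0 * leftGrunwald a b α h 0 f x
        + q.d1 * leftGrunwald a b α h 1 f x)

/-- For `f = I^{α+m} g` the derivative terms become values of `I^m g`, and the Grünwald series are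
finite sums of values of `I^{α+m} g`. All of these are continuous in `g`. -/
theorem QuasiCompact.exists_defect_clm (q : QuasiCompact) {a b α : ℝ} (hab : a < b) (h1 : 1 < α)
    (h2 : α ≤ 2) (m : ℕ) {h x : ℝ} (hh : 0 < h) (hxa : a ≤ x - h) (hxb : x + h ≤ b) :
    ∃ L : C(Icc a b, ℝ) →L[ℝ] ℝ, ∀ g : C(Icc a b, ℝ),
      L g = q.defect α a b h (leftFracInt a (α + m) (IccExtend hab.le g)) x := by
  choose J hJ using exists_leftFracInt_clm hab.le (m.cast_nonneg (α := ℝ))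
  choose G hG using exists_leftFracInt_clm (γ := α + m) hab.le (by positivity)
  -- One truncation index for the three shifts: already for `p = 1`, the `n`-th sampling point lies
  -- to the left of `a`.
  obtain ⟨n, hn⟩ := exists_nat_gt ((x - a) / h + 1)
  have hn' : x + h - a < n * h := by
    rw [← sub_pos] at hn ⊢
    have := mul_pos hn hh
    field_simp at this
    linarith
  let D (p : ℤ) : C(Icc a b, ℝ) →L[ℝ] ℝ := (1 / h ^ α) • ∑ k ∈ Finset.range n,
    grunwaldCoeff α k • G (x - ((k : ℝ) - p) * h)
  have hD (p : ℤ) (hp : p ≤ 1) (g : C(Icc a b, ℝ)) :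
      D p g = leftGrunwald a b α h p (leftFracInt a (α + m) (IccExtend hab.le g)) x := by
    rw [leftGrunwald_eq_sum (n := n) hh]
    · simp [D, hG, smul_eq_mul]
    · have : (p : ℝ) * h ≤ 1 * h := mul_le_mul_of_nonneg_right (by exact_mod_cast hp) hh.le
      nlinarith
  refine ⟨q.cm • J (x - h) + q.c0 • J x + q.c1 • J (x + h)
    - (q.dm • D (-1) + q.d0 • D 0 + q.d1 • D 1), fun g => ?_⟩
  have hc : ContinuousOn (IccExtend hab.le g) (Icc a b) := g.continuous.Icc_extend'.continuousOn
  have hJ' (y : ℝ) (hy : y ∈ Icc a b) :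
      J y g = leftRL a b α (leftFracInt a (α + m) (IccExtend hab.le g)) y := by
    rw [hJ, indicator_of_mem hy, leftRL_leftFracInt hab h1 h2 hc hy]
  have e1 := hJ' (x - h) ⟨hxa, by linarith⟩
  have e2 := hJ' x ⟨by linarith, by linarith⟩
  have e3 := hJ' (x + h) ⟨by linarith, hxb⟩
  simp [QuasiCompact.defect, e1, e2, e3, hD]

theorem leftGrunwald_congr {a b : ℝ} (α h : ℝ) (p : ℤ) {f g : ℝ → ℝ} (hfg : EqOn f g (Icc a b)) :
    leftGrunwald a b α h p f = leftGrunwald a b α h p g := by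
  funext x
  simp only [leftGrunwald, indicator_congr hfg]

theorem QuasiCompact.defect_congr (q : QuasiCompact) {a b α h x : ℝ} {f g : ℝ → ℝ}
    (hfg : EqOn f g (Icc a b)) (hh : 0 < h) (hxa : a ≤ x - h) (hxb : x + h ≤ b) :
    q.defect α a b h f x = q.defect α a b h g x := by
  unfold QuasiCompact.defect
  rw [leftRL_congr hfg ⟨hxa, by linarith⟩, leftRL_congr hfg (x := x) ⟨by linarith, by linarith⟩,
    leftRL_congr hfg (x := x + h) ⟨by linarith, hxb⟩]
  simp only [leftGrunwald_congr α h _ hfg]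

/-- By the uniform boundedness principle, the constant in an approximation of order `m` depends
on the function only through a bound for its derivative of order `α + m`. -/
theorem QuasiCompact.HasOrder.exists_uniform {q : QuasiCompact} {a b α : ℝ} {m : ℕ}
    (hq : q.HasOrder α m a b) (hab : a < b) (h1 : 1 < α) (h2 : α ≤ 2) :
    ∃ C, 0 ≤ C ∧ ∀ f : ℝ → ℝ, LeftRegular α m a b f → ∀ B : ℝ,
      (∀ x ∈ Icc a b, |leftRL a b (α + m) f x| ≤ B) →
      ∀ h x : ℝ, 0 < h → a ≤ x - h → x + h ≤ b → |q.defect α a b h f x| ≤ C * B * h ^ m := by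
  let ι := {p : ℝ × ℝ // 0 < p.1 ∧ a ≤ p.2 - p.1 ∧ p.2 + p.1 ≤ b}
  have hL (i : ι) := q.exists_defect_clm hab h1 h2 m i.2.1 i.2.2.1 i.2.2.2
  choose L hL using hL
  -- The family is indexed by all admissible pairs `(h, x)`. Its boundedness at a fixed `g` is
  -- exactly the order condition for `I^{α+m} g`.
  obtain ⟨C, hC⟩ := banach_steinhaus (g := fun i : ι => (i.1.1 ^ m)⁻¹ • L i) fun g => by
    obtain ⟨C, hC⟩ := hq _ (leftFracInt_leftRegular (m := m) hab h1 h2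
      (g := IccExtend hab.le g) g.continuous.Icc_extend'.continuousOn)
    refine ⟨C, fun i => ?_⟩
    have hi : 0 < i.1.1 ^ m := pow_pos i.2.1 m
    rw [smul_apply, norm_smul, norm_inv, Real.norm_of_nonneg hi.le,
      inv_mul_le_iff₀ hi, hL, mul_comm]
    exact hC _ _ i.2.1 i.2.2.1 i.2.2.2
  refine ⟨|C|, abs_nonneg C, fun f hf B hB h x hh hxa hxb => ?_⟩
  have hB0 : 0 ≤ B := (abs_nonneg _).trans (hB a (left_mem_Icc.2 hab.le))
  have hc := hf.continuousOn_leftRL_add hab h1 h2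
  let g : C(Icc a b, ℝ) := ⟨_, continuousOn_iff_continuous_domRestrict.1 hc⟩
  have hg : ‖g‖ ≤ B := (ContinuousMap.norm_le _ hB0).2 fun x => hB x x.2
  have hfg : EqOn f (leftFracInt a (α + m) (IccExtend hab.le g)) (Icc a b) := fun y hy => by
    rw [hf.eqOn_leftFracInt hab h1 h2 hy]
    refine leftFracInt_congr (fun z hz => ?_) hy
    rw [IccExtend_of_mem hab.le _ hz]
    rfl
  rw [q.defect_congr hfg hh hxa hxb]
  let i : ι := ⟨(h, x), hh, hxa, hxb⟩
  have hi : 0 < h ^ m := pow_pos hh m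
  have key := ((fun i : ι => (i.1.1 ^ m)⁻¹ • L i) i).le_of_opNorm_le (hC i) g
  simp only [smul_apply, norm_smul, norm_inv] at key
  rw [Real.norm_of_nonneg hi.le, inv_mul_le_iff₀ hi, hL, Real.norm_eq_abs, mul_comm] at key
  refine key.trans (mul_le_mul_of_nonneg_right ?_ hi.le)
  exact mul_le_mul (le_abs_self C) hg (norm_nonneg _) (abs_nonneg _)

/-! ### Reflection of the interval: from left to right derivatives -/

theorem leftFracInt_reflect (a b γ : ℝ) (f : ℝ → ℝ) (y : ℝ) :
    leftFracInt a γ (fun z => f (a + b - z)) y = rightFracInt b γ f (a + b - y) := by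
  unfold leftFracInt rightFracInt
  split_ifs
  · rfl
  · congr 1
    have := intervalIntegral.integral_comp_sub_left
      (fun ξ => (ξ - (a + b - y)) ^ (γ - 1) * f ξ) (a + b) (a := a) (b := y)
    rw [add_sub_cancel_left] at this
    rw [← this]
    refine intervalIntegral.integral_congr fun ξ _ => ?_
    simp only [sub_sub_sub_cancel_left]

theorem mapsTo_reflect (a b : ℝ) : MapsTo (fun y => a + b - y) (Icc a b) (Icc a b) := fun y hy =>
  ⟨by linarith [hy.2], by linarith [hy.1]⟩

open scoped Pointwise in
theorem iteratedDerivWithin_reflect (a b : ℝ) (k : ℕ) (f : ℝ → ℝ) (x : ℝ) :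
    iteratedDerivWithin k (fun y => f (a + b - y)) (Icc a b) x
      = (-1) ^ k * iteratedDerivWithin k f (Icc a b) (a + b - x) := by
  have hset : (a + b) +ᵥ -Icc a b = Icc a b := by
    ext y
    simp only [mem_vadd_set_iff_neg_vadd_mem, vadd_eq_add, Set.mem_neg, mem_Icc]
    constructor <;> rintro ⟨h1, h2⟩ <;> constructor <;> linarith
  simp only [iteratedDerivWithin_comp_const_sub, hset, smul_eq_mul]

theorem RightRegular.reflect {a b α : ℝ} {m : ℕ} {f : ℝ → ℝ} (hf : RightRegular α m a b f) :
    LeftRegular α m a b (fun y => f (a + b - y)) := by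
  have hs : ∀ n : WithTop ℕ∞, ContDiffOn ℝ n (fun y => a + b - y) (Icc a b) := fun n => by fun_prop
  refine ⟨hf.smooth.comp (hs _) (mapsTo_reflect a b), fun k hk => ?_, ?_⟩
  · rw [iteratedDerivWithin_reflect, add_sub_cancel_left, hf.vanish k hk, mul_zero]
  · exact (hf.frac.comp (hs _) (mapsTo_reflect a b)).congr fun y _ => leftFracInt_reflect a b _ f y

theorem leftRL_reflect (a b α : ℝ) (f : ℝ → ℝ) (x : ℝ) :
    leftRL a b α (fun y => f (a + b - y)) x = rightRL a b α f (a + b - x) := by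
  rw [leftRL, rightRL, ← iteratedDerivWithin_reflect]
  congr 1
  exact funext fun y => leftFracInt_reflect a b _ f y

theorem RightRegular.continuousOn_rightRL {a b α : ℝ} {m : ℕ} (hab : a < b) (h1 : 1 < α)
    (h2 : α ≤ 2) {f : ℝ → ℝ} (hf : RightRegular α m a b f) :
    ContinuousOn (rightRL a b α f) (Icc a b) := by
  have h := (hf.reflect.continuousOn_leftRL hab h1 h2).comp
    (f := fun y => a + b - y) (by fun_prop) (mapsTo_reflect a b)
  refine h.congr fun x _ => ?_
  simp [leftRL_reflect]

/-! ### Toeplitz matrices and Grünwald sums on the grid -/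

namespace QuasiCompact

/-- The convolution of the combined weights with a grid function, at the node `j`. -/
noncomputable def conv (q : QuasiCompact) (α : ℝ) (V : ℕ → ℝ) (j : ℕ) : ℝ :=
  ∑ l ∈ Finset.range (j + 2), q.w α l * V (j + 1 - l)

theorem conv_eq (q : QuasiCompact) (α : ℝ) (V : ℕ → ℝ) (j : ℕ) :
    q.conv α V j = q.dm * ∑ k ∈ Finset.range j, grunwaldCoeff α k * V (j - 1 - k)
      + q.d0 * ∑ k ∈ Finset.range (j + 1), grunwaldCoeff α k * V (j - k)
      + q.d1 * ∑ k ∈ Finset.range (j + 2), grunwaldCoeff α k * V (j + 1 - k) := by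
  rw [conv, Finset.sum_range_succ', Finset.sum_range_succ',
    Finset.sum_range_succ' _ (j + 1), Finset.sum_range_succ' _ j, Finset.sum_range_succ' _ j]
  -- The truncated `j - 1` is harmless at `j = 0`, where the sum weighted by `dm` is empty.
  have hsub (k : ℕ) : j - 1 - k = j - (k + 1) := by omega
  simp only [w, zero_add, Nat.add_sub_add_right, Nat.add_sub_cancel, Nat.sub_zero, hsub, mul_add, add_mul, Finset.mul_sum,
    Finset.sum_add_distrib, mul_assoc]
  ring_nf

/-- The matrix sees interior values only. The two boundary terms restore the full three-point
stencil at node `i + 1`, in the form in which they occur in the boundary vector. -/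
theorem matT_mulVec (q : QuasiCompact) {N : ℕ} (V : ℕ → ℝ) (i : Fin (N - 1)) :
    (q.matT N).mulVec (DiffusionProblem.interior N V) i
      + (if (i : ℕ) + 1 = 1 then q.cm else 0) * V 0
      + (if (i : ℕ) + 1 = N - 1 then q.c1 else 0) * V N
      = q.cm * V i + q.c0 * V (i + 1) + q.c1 * V (i + 2) := by
  obtain ⟨i, hi⟩ := i
  have hsum : (q.matT N).mulVec (DiffusionProblem.interior N V) ⟨i, hi⟩
      = ∑ c ∈ Finset.range (N - 1), ((if c = i then q.c0 * V (i + 1) else 0)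
        + (if c = i + 1 then q.c1 * V (i + 2) else 0)
        + (if c + 1 = i then q.cm * V i else 0)) := by
    rw [← Fin.sum_univ_eq_sum_range (fun c => (if c = i then q.c0 * V (i + 1) else 0)
        + (if c = i + 1 then q.c1 * V (i + 2) else 0) + (if c + 1 = i then q.cm * V i else 0))]
    simp only [Matrix.mulVec, dotProduct]
    refine Finset.sum_congr rfl fun c _ => ?_
    simp only [matT, DiffusionProblem.interior]
    by_cases h1 : (c : ℕ) = i
    · simp [h1]
    by_cases h2 : (c : ℕ) = i + 1
    · have : i + 1 + 1 ≠ i := by omega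
      simp [h2, this]
    by_cases h3 : (c : ℕ) + 1 = i
    · have : (c : ℕ) ≠ c + 1 + 1 := by omega
      simp [← h3, this]
    · simp [h1, h2, h3, Ne.symm h3]
  have hm : ∑ c ∈ Finset.range (N - 1), (if c + 1 = i then q.cm * V i else 0)
      = (if i = 0 then 0 else q.cm * V i) := by
    rcases Nat.eq_zero_or_pos i with h | h
    · simp [h]
    · rw [if_neg h.ne', Finset.sum_eq_single (i - 1), if_pos (by omega)]
      · intro c _ hc
        rw [if_neg (by omega)]
      · intro hc
        exact absurd (Finset.mem_range.2 (by omega)) hc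
  rw [hsum, Finset.sum_add_distrib, Finset.sum_add_distrib, hm, Finset.sum_ite_eq',
    Finset.sum_ite_eq', if_pos (Finset.mem_range.2 hi)]
  simp only [Finset.mem_range]
  have hN : (if i + 1 < N - 1 then q.c1 * V (i + 2) else 0)
      + (if i + 1 = N - 1 then q.c1 else 0) * V N = q.c1 * V (i + 2) := by
    rcases Nat.lt_or_ge (i + 1) (N - 1) with h | h
    · rw [if_pos h, if_neg (by omega)]; ring
    · rw [if_neg (by omega), if_pos (by omega), show N = i + 2 by omega]; ring
  have h0 : (if i = 0 then 0 else q.cm * V i) + (if i + 1 = 1 then q.cm else 0) * V 0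
      = q.cm * V i := by
    rcases Nat.eq_zero_or_pos i with h | h
    · simp [h]
    · rw [if_neg (by omega), if_neg (by omega)]; ring
  linarith

theorem matA_mulVec (q : QuasiCompact) (α : ℝ) {N : ℕ} (V : ℕ → ℝ) (i : Fin (N - 1)) :
    (q.matA α N).mulVec (DiffusionProblem.interior N V) i
      + q.w α (i + 2) * V 0 + (if (i : ℕ) + 1 = N - 1 then q.w α 0 else 0) * V N
      = q.conv α V (i + 1) := by
  obtain ⟨i, hi⟩ := i
  have hsum : (q.matA α N).mulVec (DiffusionProblem.interior N V) ⟨i, hi⟩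
      = ∑ c ∈ Finset.range (N - 1), if c ≤ i + 1 then q.w α (i + 1 - c) * V (c + 1) else 0 := by
    rw [← Fin.sum_univ_eq_sum_range
      (fun c => if c ≤ i + 1 then q.w α (i + 1 - c) * V (c + 1) else 0)]
    simp only [Matrix.mulVec, dotProduct]
    refine Finset.sum_congr rfl fun c _ => ?_
    simp only [matA, DiffusionProblem.interior, ite_mul, zero_mul]
  have hconv : q.conv α V (i + 1)
      = ∑ c ∈ Finset.range (i + 2), q.w α (i + 1 - c) * V (c + 1) + q.w α (i + 2) * V 0 := by
    rw [conv, ← Finset.sum_range_reflect, Finset.sum_range_succ']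
    congr 1
    swap
    · simp
    refine Finset.sum_congr rfl fun c hc => ?_
    rw [Finset.mem_range] at hc
    rw [show i + 1 + 2 - 1 - (c + 1) = i + 1 - c by omega,
      show i + 1 + 1 - (i + 1 - c) = c + 1 by omega]
  have hle (n : ℕ) (hn : n ≤ i + 2) :
      ∑ c ∈ Finset.range n, (if c ≤ i + 1 then q.w α (i + 1 - c) * V (c + 1) else 0)
        = ∑ c ∈ Finset.range n, q.w α (i + 1 - c) * V (c + 1) :=
    Finset.sum_congr rfl fun c hc => if_pos (by rw [Finset.mem_range] at hc; omega)
  rw [hsum, hconv]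
  dsimp only
  rcases Nat.lt_or_ge (i + 1) (N - 1) with h | h
  · rw [if_neg (by omega), ← hle _ le_rfl]
    have : ∑ c ∈ Finset.range (N - 1), (if c ≤ i + 1 then q.w α (i + 1 - c) * V (c + 1) else 0)
        = ∑ c ∈ Finset.range (i + 2), if c ≤ i + 1 then q.w α (i + 1 - c) * V (c + 1) else 0 := by
      refine (Finset.sum_subset (Finset.range_mono (by omega)) fun c _ hc => if_neg ?_).symm
      rw [Finset.mem_range] at hc; omega
    rw [this]
    ring
  · rw [if_pos (by omega), Finset.sum_range_succ, show N - 1 = i + 1 by omega,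
      hle _ (by omega), show N = i + 2 by omega, Nat.sub_self]
    ring

/-- Transposing a Toeplitz matrix amounts to reversing the order of the indices, so this is
`matA_mulVec` for the reflected grid function. -/
theorem matA_transpose_mulVec (q : QuasiCompact) (α : ℝ) {N : ℕ} (V : ℕ → ℝ) (i : Fin (N - 1)) :
    (q.matA α N).transpose.mulVec (DiffusionProblem.interior N V) i
      + q.w α (N - i) * V N + (if (i : ℕ) + 1 = 1 then q.w α 0 else 0) * V 0
      = q.conv α (fun k => V (N - k)) (N - (i + 1)) := by
  have hi := i.2
  have h := q.matA_mulVec α (fun k => V (N - k)) i.rev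
  have hrev : (i.rev : ℕ) = N - 1 - (i + 1) := Fin.val_rev i
  have hA : (q.matA α N).mulVec (DiffusionProblem.interior N fun k => V (N - k)) i.rev
      = (q.matA α N).transpose.mulVec (DiffusionProblem.interior N V) i := by
    simp only [Matrix.mulVec, dotProduct, Matrix.transpose_apply, matA,
      DiffusionProblem.interior]
    rw [← Equiv.sum_comp Fin.revPerm]
    refine Finset.sum_congr rfl fun c _ => ?_
    have hc := c.2
    have hcrev : (c.rev : ℕ) = N - 1 - (c + 1) := Fin.val_rev c
    simp only [Fin.revPerm_apply, hrev, hcrev]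
    rw [show N - (N - 1 - ((c : ℕ) + 1) + 1) = c + 1 by omega]
    by_cases h' : (i : ℕ) ≤ c + 1
    · rw [if_pos (by omega), if_pos h']
      congr 2
      omega
    · rw [if_neg (by omega), if_neg h']
  rw [hA, hrev, Nat.sub_self, Nat.sub_zero] at h
  rw [show N - ((i : ℕ) + 1) = N - 1 - (i + 1) + 1 by omega, ← h,
    show N - 1 - ((i : ℕ) + 1) + 2 = N - i by omega]
  have : (N - 1 - ((i : ℕ) + 1) + 1 = N - 1) = ((i : ℕ) + 1 = 1) := by
    rw [eq_iff_iff]; omega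
  simp only [this]

/-- Here `n = j + p + 1` counts the nodes from `j + p` down to `0`. The condition `n ≤ N + 1` keeps
node `j + p` inside `[a, b]`, where the extension by zero agrees with `f`. -/
theorem grunwald_node (α : ℝ) {a b h : ℝ} {N j n : ℕ} {p : ℤ} (hh : 0 < h)
    (hN : a + N * h = b) (hn : (n : ℤ) = j + p + 1) (hnN : n ≤ N + 1) (f : ℝ → ℝ) :
    leftGrunwald a b α h p f (a + j * h)
      = (1 / h ^ α) * ∑ k ∈ Finset.range n, grunwaldCoeff α k * f (a + ((n - 1 - k : ℕ) : ℝ) * h) := by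
  have hn' : (n : ℝ) = j + p + 1 := by exact_mod_cast hn
  rw [leftGrunwald_eq_sum (n := n) hh (by rw [hn']; ring_nf; linarith)]
  congr 1
  refine Finset.sum_congr rfl fun k hk => ?_
  rw [Finset.mem_range] at hk
  have hcast : ((n - 1 - k : ℕ) : ℝ) = n - 1 - k := by
    rw [Nat.sub_sub, Nat.cast_sub (by omega)]; push_cast; ring
  have hx : a + (j : ℝ) * h - ((k : ℝ) - p) * h = a + ((n - 1 - k : ℕ) : ℝ) * h := by
    rw [hcast, hn']; ring
  have hle : ((n - 1 - k : ℕ) : ℝ) * h ≤ N * h :=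
    mul_le_mul_of_nonneg_right (by exact_mod_cast (by omega : n - 1 - k ≤ N)) hh.le
  rw [hx, indicator_of_mem]
  exact ⟨by have : 0 ≤ ((n - 1 - k : ℕ) : ℝ) * h := by positivity
            linarith, by linarith⟩

theorem grunwald_comb_node (q : QuasiCompact) (α : ℝ) {a b h : ℝ} {N j : ℕ} (hh : 0 < h)
    (hN : a + N * h = b) (hjN : j + 1 ≤ N) (f : ℝ → ℝ) :
    q.dm * leftGrunwald a b α h (-1) f (a + j * h) + q.d0 * leftGrunwald a b α h 0 f (a + j * h)
      + q.d1 * leftGrunwald a b α h 1 f (a + j * h)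
      = (1 / h ^ α) * q.conv α (fun k => f (a + k * h)) j := by
  rw [grunwald_node α (n := j) hh hN (by ring) (by omega),
    grunwald_node α (n := j + 1) hh hN (by push_cast; ring) (by omega),
    grunwald_node α (n := j + 2) hh hN (by push_cast; ring) (by omega), conv_eq]
  simp only [Nat.add_sub_cancel, show j + 2 - 1 = j + 1 from rfl]
  ring

end QuasiCompact

/-! ### Taylor and quadrature errors in time -/

theorem ContDiffOn.hasDerivWithinAt_iteratedDerivWithin {v : ℝ → ℝ} {s : Set ℝ} {n k : ℕ}
    (hv : ContDiffOn ℝ (n : WithTop ℕ∞) v s) (hs : UniqueDiffOn ℝ s) (hk : k < n) {x : ℝ}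
    (hx : x ∈ s) :
    HasDerivWithinAt (iteratedDerivWithin k v s) (iteratedDerivWithin (k + 1) v s x) s x := by
  rw [iteratedDerivWithin_succ]
  exact (hv.differentiableOn_iteratedDerivWithin (by exact_mod_cast hk) hs x hx).hasDerivWithinAt

theorem abs_sub_le_of_hasDerivWithinAt {φ φ' : ℝ → ℝ} {T M s t : ℝ}
    (hd : ∀ x ∈ Icc 0 T, HasDerivWithinAt φ (φ' x) (Icc 0 T) x) (hs : s ∈ Icc 0 T)
    (ht : t ∈ Icc 0 T) (hM : ∀ x ∈ uIcc s t, |φ' x| ≤ M) : |φ t - φ s| ≤ M * |t - s| := by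
  have hsub : uIcc s t ⊆ Icc 0 T := uIcc_subset_Icc hs ht
  exact Convex.norm_image_sub_le_of_norm_hasDerivWithin_le
    (fun x hx => (hd x (hsub hx)).mono hsub) hM (convex_uIcc s t) left_mem_uIcc right_mem_uIcc

/-- Taylor's formula of first order. -/
theorem taylor_first_order_bound {v : ℝ → ℝ} {T M s t : ℝ} (hT : 0 < T)
    (hv : ContDiffOn ℝ ((2 : ℕ) : WithTop ℕ∞) v (Icc 0 T))
    (hM : ∀ x ∈ Icc 0 T, |iteratedDerivWithin 2 v (Icc 0 T) x| ≤ M) (hs : s ∈ Icc 0 T)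
    (ht : t ∈ Icc 0 T) :
    |v t - v s - (t - s) * iteratedDerivWithin 1 v (Icc 0 T) s| ≤ M * |t - s| ^ 2 := by
  have hu := uniqueDiffOn_Icc hT
  have hM0 : 0 ≤ M := (abs_nonneg _).trans (hM s hs)
  have hsub : uIcc s t ⊆ Icc 0 T := uIcc_subset_Icc hs ht
  have h0 (x : ℝ) (hx : x ∈ Icc 0 T) :
      HasDerivWithinAt v (iteratedDerivWithin 1 v (Icc 0 T) x) (Icc 0 T) x := by
    simpa using hv.hasDerivWithinAt_iteratedDerivWithin (k := 0) hu two_pos hx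
  set d := iteratedDerivWithin 1 v (Icc 0 T) s
  have hE (x : ℝ) (hx : x ∈ Icc 0 T) : HasDerivWithinAt (fun y => v y - (y - s) * d)
      (iteratedDerivWithin 1 v (Icc 0 T) x - d) (Icc 0 T) x := by
    refine ((h0 x hx).sub
      (((hasDerivWithinAt_id x (Icc 0 T)).sub_const s).mul_const d)).congr_deriv ?_
    ring
  have := abs_sub_le_of_hasDerivWithinAt hE hs ht (M := M * |t - s|) fun x hx => by
    have h1 := abs_sub_le_of_hasDerivWithinAt
      (fun x hx => hv.hasDerivWithinAt_iteratedDerivWithin (k := 1) hu one_lt_two hx) hs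
      (hsub hx) (M := M) fun y hy =>
        hM y (uIcc_subset_Icc hs (hsub hx) hy)
    exact h1.trans (mul_le_mul_of_nonneg_left (abs_sub_left_of_mem_uIcc hx) hM0)
  calc _ = |v t - (t - s) * d - (v s - (s - s) * d)| := by congr 1; ring
    _ ≤ _ := this.trans_eq (by ring)

/-- Expanding both end values about the midpoint, the linear terms cancel. The constant is not
optimal. -/
theorem midpoint_average_bound {v : ℝ → ℝ} {T M s t : ℝ} (hT : 0 < T)
    (hv : ContDiffOn ℝ ((2 : ℕ) : WithTop ℕ∞) v (Icc 0 T))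
    (hM : ∀ x ∈ Icc 0 T, |iteratedDerivWithin 2 v (Icc 0 T) x| ≤ M) (hs : s ∈ Icc 0 T)
    (ht : t ∈ Icc 0 T) : |(v s + v t) / 2 - v ((s + t) / 2)| ≤ M * (t - s) ^ 2 := by
  have hM0 : 0 ≤ M := (abs_nonneg _).trans (hM s hs)
  have hc : (s + t) / 2 ∈ Icc 0 T := ⟨by linarith [hs.1, ht.1], by linarith [hs.2, ht.2]⟩
  have h1 := taylor_first_order_bound hT hv hM hc hs
  have h2 := taylor_first_order_bound hT hv hM hc ht
  rw [sq_abs] at h1 h2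
  rw [abs_le] at *
  have : 0 ≤ M * (t - s) ^ 2 := by positivity
  constructor <;> nlinarith

/-- As a function of the end point `y`, the error has derivative `(G y - G s) / 2` with `G y = v' y
- (y - s) v'' y`, and `G' y = -(y - s) v''' y`. Two mean value estimates give the cubic bound. -/
theorem trapezoid_bound {v : ℝ → ℝ} {T M s t : ℝ} (hT : 0 < T)
    (hv : ContDiffOn ℝ ((3 : ℕ) : WithTop ℕ∞) v (Icc 0 T))
    (hM : ∀ x ∈ Icc 0 T, |iteratedDerivWithin 3 v (Icc 0 T) x| ≤ M) (hs : s ∈ Icc 0 T)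
    (ht : t ∈ Icc 0 T) :
    |v t - v s - (t - s) * ((iteratedDerivWithin 1 v (Icc 0 T) s
      + iteratedDerivWithin 1 v (Icc 0 T) t) / 2)| ≤ M * |t - s| ^ 3 := by
  have hu := uniqueDiffOn_Icc hT
  have hM0 : 0 ≤ M := (abs_nonneg _).trans (hM s hs)
  have hsub : uIcc s t ⊆ Icc 0 T := uIcc_subset_Icc hs ht
  have h0 (x : ℝ) (hx : x ∈ Icc 0 T) :
      HasDerivWithinAt v (iteratedDerivWithin 1 v (Icc 0 T) x) (Icc 0 T) x := by
    simpa using hv.hasDerivWithinAt_iteratedDerivWithin (k := 0) hu three_pos hx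
  have h1 (x : ℝ) (hx : x ∈ Icc 0 T) := hv.hasDerivWithinAt_iteratedDerivWithin
    (k := 1) hu (by norm_num) hx
  have h2 (x : ℝ) (hx : x ∈ Icc 0 T) := hv.hasDerivWithinAt_iteratedDerivWithin
    (k := 2) hu (by norm_num) hx
  set v1 := iteratedDerivWithin 1 v (Icc 0 T)
  set v2 := iteratedDerivWithin (1 + 1) v (Icc 0 T)
  set v3 := iteratedDerivWithin (2 + 1) v (Icc 0 T)
  have hid (x : ℝ) : HasDerivWithinAt (fun y => y - s) 1 (Icc 0 T) x :=
    (hasDerivWithinAt_id x (Icc 0 T)).sub_const s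
  have hG (x : ℝ) (hx : x ∈ Icc 0 T) : HasDerivWithinAt (fun y => v1 y - (y - s) * v2 y)
      (-(x - s) * v3 x) (Icc 0 T) x := by
    refine ((h1 x hx).sub ((hid x).mul (h2 x hx))).congr_deriv ?_
    change v2 x - (1 * v2 x + (x - s) * v3 x) = _
    ring
  have hE (x : ℝ) (hx : x ∈ Icc 0 T) :
      HasDerivWithinAt (fun y => v y - (y - s) * ((v1 s + v1 y) / 2))
        ((v1 x - (x - s) * v2 x - v1 s) / 2) (Icc 0 T) x := by
    refine ((h0 x hx).sub ((hid x).mul (((h1 x hx).const_add (v1 s)).div_const 2))).congr_deriv ?_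
    ring
  have := abs_sub_le_of_hasDerivWithinAt hE hs ht (M := M * |t - s| ^ 2) fun x hx => by
    have hx' : |x - s| ≤ |t - s| := abs_sub_left_of_mem_uIcc hx
    have := abs_sub_le_of_hasDerivWithinAt hG hs (hsub hx) (M := M * |t - s|) fun y hy => by
      rw [abs_mul, abs_neg, mul_comm]
      exact mul_le_mul (hM y (uIcc_subset_Icc hs (hsub hx) hy))
        ((abs_sub_left_of_mem_uIcc hy).trans hx') (abs_nonneg _) hM0
    rw [sub_self, zero_mul, sub_zero] at this
    have h3 : M * |t - s| * |x - s| ≤ M * |t - s| ^ 2 := by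
      rw [pow_two, ← mul_assoc]
      exact mul_le_mul_of_nonneg_left hx' (by positivity)
    have h4 : 0 ≤ M * |t - s| ^ 2 := by positivity
    rw [abs_div, abs_two]
    linarith
  calc _ = |v t - (t - s) * ((v1 s + v1 t) / 2) - (v s - (s - s) * ((v1 s + v1 s) / 2))| := by
        congr 1; ring
    _ ≤ _ := this.trans_eq (by ring)

/-! ### Stability of the Crank-Nicolson recursion -/

/-- The norm of the square root of a coercive form grows at most linearly along a
Crank-Nicolson recursion with dissipative second operator. -/
theorem crankNicolson_energy {n M : ℕ} {T S : Matrix (Fin n) (Fin n) ℝ} {lam r : ℝ}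
    (hlam : 0 < lam) (hr : 0 ≤ r) (hT : T.IsSymm)
    (hTpos : ∀ v : Fin n → ℝ, lam * (v ⬝ᵥ v) ≤ v ⬝ᵥ T.mulVec v)
    (hS : ∀ v : Fin n → ℝ, v ⬝ᵥ S.mulVec v ≤ 0) {e ρ : ℕ → Fin n → ℝ} (he : e 0 = 0)
    (hstep : ∀ k < M, (T - S).mulVec (e (k + 1)) = (T + S).mulVec (e k) + ρ k)
    (hρ : ∀ k < M, √(ρ k ⬝ᵥ ρ k) ≤ r) : ∀ k ≤ M, √(e k ⬝ᵥ e k) ≤ k * r / lam := by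
  have hnorm (v : Fin n → ℝ) : √(v ⬝ᵥ v) = ‖WithLp.toLp 2 v‖ := by
    rw [EuclideanSpace.norm_eq]
    congr 1
    exact Finset.sum_congr rfl fun i _ => by simp [pow_two]
  have hsl : 0 < √lam := Real.sqrt_pos.2 hlam
  set E : (Fin n → ℝ) → ℝ := fun v => √(v ⬝ᵥ T.mulVec v) with hE
  have hTnn (v : Fin n → ℝ) : 0 ≤ v ⬝ᵥ T.mulVec v := (hTpos v).trans' <|
    mul_nonneg hlam.le (Finset.sum_nonneg fun i _ => mul_self_nonneg (v i))
  have hle (v : Fin n → ℝ) : √lam * √(v ⬝ᵥ v) ≤ E v := by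
    rw [← Real.sqrt_mul hlam.le]
    exact Real.sqrt_le_sqrt (hTpos v)
  have hind : ∀ k ≤ M, E (e k) ≤ k * (r / √lam) := by
    intro k
    induction k with
    | zero => intro _; simp [hE, he]
    | succ k ih =>
      intro hk
      have ihk := ih (by omega)
      set v := e k
      set v' := e (k + 1)
      have hst := hstep k hk
      -- The recursion reads `T (v' - v) = S (v' + v) + ρ`; pairing it with `v' + v` makes the `S`
      -- term a quadratic form, hence nonpositive.
      have h1 : (v' + v) ⬝ᵥ T.mulVec (v' - v) = (v' + v) ⬝ᵥ S.mulVec (v' + v) + (v' + v) ⬝ᵥ ρ k := by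
        have : T.mulVec (v' - v) = S.mulVec (v' + v) + ρ k := by
          rw [Matrix.sub_mulVec, Matrix.add_mulVec] at hst
          rw [Matrix.mulVec_sub, Matrix.mulVec_add]
          funext i
          have := congrFun hst i
          simp only [Pi.add_apply, Pi.sub_apply] at this ⊢
          linarith
        rw [this, dotProduct_add]
      have hsym : v' ⬝ᵥ T.mulVec v = v ⬝ᵥ T.mulVec v' := by
        rw [Matrix.dotProduct_mulVec, ← Matrix.mulVec_transpose, hT.eq, dotProduct_comm]
      have h2 : (v' + v) ⬝ᵥ T.mulVec (v' - v) = E v' ^ 2 - E v ^ 2 := by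
        rw [Real.sq_sqrt (hTnn v'), Real.sq_sqrt (hTnn v), Matrix.mulVec_sub, dotProduct_sub,
          add_dotProduct, add_dotProduct, hsym]
        ring
      have h3 : (v' + v) ⬝ᵥ ρ k ≤ √((v' + v) ⬝ᵥ (v' + v)) * r := by
        have : (v' + v) ⬝ᵥ ρ k ≤ √((v' + v) ⬝ᵥ (v' + v)) * √(ρ k ⬝ᵥ ρ k) := by
          rw [hnorm, hnorm, mul_comm]
          refine le_trans (le_of_eq ?_)
            (real_inner_le_norm (WithLp.toLp 2 (ρ k)) (WithLp.toLp 2 (v' + v)))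
          rw [EuclideanSpace.inner_toLp_toLp]
          simp
        exact this.trans (mul_le_mul_of_nonneg_left (hρ k hk) (Real.sqrt_nonneg _))
      have h4 : √((v' + v) ⬝ᵥ (v' + v)) ≤ √(v' ⬝ᵥ v') + √(v ⬝ᵥ v) := by
        rw [hnorm, hnorm, hnorm, WithLp.toLp_add]
        exact norm_add_le _ _
      have h5 : E v' ^ 2 - E v ^ 2 ≤ (E v' + E v) * (r / √lam) := by
        have h6 : √(v' ⬝ᵥ v') + √(v ⬝ᵥ v) ≤ (E v' + E v) / √lam := by
          rw [le_div_iff₀ hsl]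
          linarith [hle v', hle v]
        have h7 := mul_le_mul_of_nonneg_right (h4.trans h6) hr
        have h8 : (E v' + E v) / √lam * r = (E v' + E v) * (r / √lam) := by ring
        linarith [hS (v' + v)]
      have hE' : 0 ≤ E v' := Real.sqrt_nonneg _
      have hE0 : 0 ≤ E v := Real.sqrt_nonneg _
      -- This divides `h5` by `E v' + E v`. Arguing by contradiction covers the case of a vanishing
      -- sum, since failure of the bound forces `E v' > 0`.
      have h9 : E v' ≤ E v + r / √lam := by
        by_contra hcon
        push Not at hcon
        have : 0 ≤ r / √lam := by positivity
        nlinarith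
      push_cast
      linarith
  intro k hk
  have h1 := (hle (e k)).trans (hind k hk)
  rw [le_div_iff₀ hlam]
  have h2 : √lam * √lam = lam := Real.mul_self_sqrt hlam.le
  calc √(e k ⬝ᵥ e k) * lam = √lam * (√lam * √(e k ⬝ᵥ e k)) := by
        rw [← mul_assoc, h2, mul_comm]
    _ ≤ √lam * (k * (r / √lam)) := mul_le_mul_of_nonneg_left h1 hsl.le
    _ = k * r := by field_simp

/-! ### Consistency of the exact solution in space -/

namespace QuasiCompact

theorem conv_congr (q : QuasiCompact) (α : ℝ) {V W : ℕ → ℝ} {j : ℕ}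
    (h : ∀ k ≤ j + 1, V k = W k) : q.conv α V j = q.conv α W j :=
  Finset.sum_congr rfl fun l _ => by rw [h _ (Nat.sub_le _ _)]

theorem defect_node (q : QuasiCompact) {α a b h : ℝ} {N i : ℕ} (hh : 0 < h)
    (hN : a + N * h = b) (hi : i + 2 ≤ N) (f : ℝ → ℝ) :
    q.defect α a b h f (a + (i + 1 : ℕ) * h)
      = q.cm * leftRL a b α f (a + i * h) + q.c0 * leftRL a b α f (a + (i + 1 : ℕ) * h)
        + q.c1 * leftRL a b α f (a + (i + 2 : ℕ) * h)
        - (1 / h ^ α) * q.conv α (fun k => f (a + k * h)) (i + 1) := by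
  have e1 : a + (i + 1 : ℕ) * h - h = a + i * h := by push_cast; ring
  have e2 : a + (i + 1 : ℕ) * h + h = a + (i + 2 : ℕ) * h := by push_cast; ring
  rw [← q.grunwald_comb_node α hh hN hi, defect, e1, e2]

/-- Reflection sends node `i + 1` to node `N - (i + 1)` and swaps its two neighbours, hence the
outer weights; this is where `cm = c1` enters. -/
theorem defect_node_reflect (q : QuasiCompact) (hsymm : q.cm = q.c1) {α a b h : ℝ} {N i : ℕ}
    (hh : 0 < h) (hN : a + N * h = b) (hi : i + 2 ≤ N) (f : ℝ → ℝ) :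
    q.defect α a b h (fun y => f (a + b - y)) (b - (i + 1 : ℕ) * h)
      = q.cm * rightRL a b α f (a + i * h) + q.c0 * rightRL a b α f (a + (i + 1 : ℕ) * h)
        + q.c1 * rightRL a b α f (a + (i + 2 : ℕ) * h)
        - (1 / h ^ α) * q.conv α (fun k => f (a + (N - k : ℕ) * h)) (N - (i + 1)) := by
  obtain ⟨l, rfl⟩ := Nat.exists_eq_add_of_le hi
  have hx : b - (i + 1 : ℕ) * h = a + (l + 1 : ℕ) * h := by rw [← hN]; push_cast; ring
  rw [hx, q.defect_node hh hN (by omega), leftRL_reflect, leftRL_reflect, leftRL_reflect,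
    show i + 2 + l - (i + 1) = l + 1 by omega,
    q.conv_congr α (W := fun k => f (a + (i + 2 + l - k : ℕ) * h)) (j := l + 1) fun k hk => ?_]
  · rw [hsymm, show a + b - (a + (l : ℝ) * h) = a + (i + 2 : ℕ) * h by rw [← hN]; push_cast; ring,
      show a + b - (a + (l + 1 : ℕ) * h) = a + (i + 1 : ℕ) * h by rw [← hN]; push_cast; ring,
      show a + b - (a + (l + 2 : ℕ) * h) = a + i * h by rw [← hN]; push_cast; ring]
    ring
  · rw [Nat.cast_sub (by omega), ← hN]
    congr 1
    ring

end QuasiCompact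

namespace DiffusionProblem

theorem h_pos (P : DiffusionProblem) {N : ℕ} (hN : 0 < N) : 0 < P.h N :=
  div_pos (sub_pos.2 P.xL_lt_xR) (Nat.cast_pos.2 hN)

theorem xL_add_mul_h (P : DiffusionProblem) {N : ℕ} (hN : 0 < N) : P.xL + N * P.h N = P.xR := by
  have : (N : ℝ) ≠ 0 := Nat.cast_ne_zero.2 hN.ne'
  rw [h]
  field_simp
  ring

theorem x_mem (P : DiffusionProblem) {N k : ℕ} (hN : 0 < N) (hk : k ≤ N) :
    P.x N k ∈ Icc P.xL P.xR := by
  have hh := P.h_pos hN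
  have h1 : (k : ℝ) * P.h N ≤ N * P.h N :=
    mul_le_mul_of_nonneg_right (Nat.cast_le.2 hk) hh.le
  rw [x, ← P.xL_add_mul_h hN]
  exact ⟨le_add_of_nonneg_right (by positivity), by linarith⟩

theorem τ_pos (P : DiffusionProblem) {M : ℕ} (hM : 0 < M) : 0 < P.τ M :=
  div_pos P.Tf_pos (Nat.cast_pos.2 hM)

theorem mul_τ (P : DiffusionProblem) {M : ℕ} (hM : 0 < M) : M * P.τ M = P.Tf := by
  have : (M : ℝ) ≠ 0 := Nat.cast_ne_zero.2 hM.ne'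
  rw [τ]
  field_simp

theorem t_mem (P : DiffusionProblem) {M n : ℕ} (hM : 0 < M) (hn : n ≤ M) :
    P.t M n ∈ Icc 0 P.Tf := by
  have hτ := P.τ_pos hM
  rw [t, ← P.mul_τ hM]
  exact ⟨by positivity, mul_le_mul_of_nonneg_right (Nat.cast_le.2 hn) hτ.le⟩

theorem TimeSmooth.continuousOn_right {P : DiffusionProblem} {k j : ℕ} {v : ℝ → ℝ → ℝ}
    (hv : P.TimeSmooth k v) (hj : j ≤ k) {x : ℝ} (hx : x ∈ Icc P.xL P.xR) :
    ContinuousOn (fun t => iteratedDerivWithin j (v x) (Icc 0 P.Tf) t) (Icc 0 P.Tf) :=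
  (hv.2 j hj).comp (f := fun t => (x, t)) (by fun_prop) fun _ ht => ⟨hx, ht⟩

theorem TimeSmooth.continuousOn_left {P : DiffusionProblem} {k j : ℕ} {v : ℝ → ℝ → ℝ}
    (hv : P.TimeSmooth k v) (hj : j ≤ k) {t : ℝ} (ht : t ∈ Icc 0 P.Tf) :
    ContinuousOn (fun x => iteratedDerivWithin j (v x) (Icc 0 P.Tf) t) (Icc P.xL P.xR) :=
  (hv.2 j hj).comp (f := fun x => (x, t)) (by fun_prop) fun _ hx => ⟨hx, ht⟩

theorem TimeSmooth.exists_bound {P : DiffusionProblem} {k j : ℕ} {v : ℝ → ℝ → ℝ}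
    (hv : P.TimeSmooth k v) (hj : j ≤ k) :
    ∃ B, 0 ≤ B ∧ ∀ x ∈ Icc P.xL P.xR, ∀ t ∈ Icc 0 P.Tf,
      |iteratedDerivWithin j (v x) (Icc 0 P.Tf) t| ≤ B := by
  obtain ⟨B, hB⟩ := (isCompact_Icc.prod isCompact_Icc).exists_bound_of_continuousOn (hv.2 j hj)
  exact ⟨|B|, abs_nonneg B, fun x hx t ht => (hB (x, t) ⟨hx, ht⟩).trans (le_abs_self B)⟩

/-- The equation holds up to the lateral boundary. -/
theorem IsExactSolution.pde_closed {P : DiffusionProblem} {m : ℕ} {u : ℝ → ℝ → ℝ}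
    (hu : P.IsExactSolution u) (hreg : P.IsRegular m u) {x t : ℝ} (hx : x ∈ Icc P.xL P.xR)
    (ht : t ∈ Ioo 0 P.Tf) :
    iteratedDerivWithin 1 (u x) (Icc 0 P.Tf) t - P.f x t
      = P.K₁ * leftRL P.xL P.xR P.α (fun y => u y t) x
        + P.K₂ * rightRL P.xL P.xR P.α (fun y => u y t) x := by
  have ht' : t ∈ Icc 0 P.Tf := Ioo_subset_Icc_self ht
  have hf : ContinuousOn (fun x => P.f x t) (Icc P.xL P.xR) := by
    simpa using hreg.time_f.continuousOn_left (j := 0) (Nat.zero_le _) ht'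
  have hl : ContinuousOn (fun x => P.K₁ * leftRL P.xL P.xR P.α (fun y => u y t) x)
      (Icc P.xL P.xR) := by
    by_cases hK : P.K₁ = 0
    · simp only [hK, zero_mul]; exact continuousOn_const
    · exact continuousOn_const.mul (((hreg.space_left hK).1 t ht').continuousOn_leftRL P.xL_lt_xR
        P.one_lt_α P.α_le_two)
  have hr : ContinuousOn (fun x => P.K₂ * rightRL P.xL P.xR P.α (fun y => u y t) x)
      (Icc P.xL P.xR) := by
    by_cases hK : P.K₂ = 0
    · simp only [hK, zero_mul]; exact continuousOn_const
    · exact continuousOn_const.mul (((hreg.space_right hK).1 t ht').continuousOn_rightRL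
        P.xL_lt_xR P.one_lt_α P.α_le_two)
  refine EqOn.of_subset_closure (s := Ioo P.xL P.xR) (t := Icc P.xL P.xR)
    (f := fun x => iteratedDerivWithin 1 (u x) (Icc 0 P.Tf) t - P.f x t) (fun x hx => ?_)
    ((hreg.time_u.continuousOn_left (by norm_num) ht').sub hf) (hl.add hr) Ioo_subset_Icc_self
    (closure_Ioo P.xL_lt_xR.ne).ge hx
  have := (hu.pde x hx t ht).hasDerivWithinAt.derivWithin
    (uniqueDiffOn_Icc P.Tf_pos t ht')
  simp only [iteratedDerivWithin_one, Pi.add_apply]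
  rw [this]
  ring

theorem exists_left_consistency {P : DiffusionProblem} {q : QuasiCompact} {m : ℕ}
    (hq : q.HasOrder P.α m P.xL P.xR) {u : ℝ → ℝ → ℝ} (hreg : P.IsRegular m u) :
    ∃ C, 0 ≤ C ∧ ∀ t ∈ Icc 0 P.Tf, ∀ N i : ℕ, i + 2 ≤ N →
      |P.K₁ * (q.cm * leftRL P.xL P.xR P.α (fun y => u y t) (P.x N i)
        + q.c0 * leftRL P.xL P.xR P.α (fun y => u y t) (P.x N (i + 1))
        + q.c1 * leftRL P.xL P.xR P.α (fun y => u y t) (P.x N (i + 2))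
        - (1 / P.h N ^ P.α) * q.conv P.α (fun k => u (P.x N k) t) (i + 1))|
        ≤ C * P.h N ^ m := by
  -- Without left diffusion no left regularity of `u` is available, but the factor `K₁` removes the
  -- term.
  by_cases hK : P.K₁ = 0
  · exact ⟨0, le_rfl, fun t _ N i _ => by simp [hK]⟩
  obtain ⟨hl, B, hB⟩ := hreg.space_left hK
  obtain ⟨C, hC, h⟩ := hq.exists_uniform P.xL_lt_xR P.one_lt_α P.α_le_two
  have hB0 : 0 ≤ B := (abs_nonneg _).trans
    (hB 0 ⟨le_rfl, P.Tf_pos.le⟩ P.xL ⟨le_rfl, P.xL_lt_xR.le⟩)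
  have hK0 := P.K₁_nonneg
  refine ⟨P.K₁ * (C * B), by positivity, fun t ht N i hi => ?_⟩
  have hh : 0 < P.h N := P.h_pos (by omega)
  have hN := P.xL_add_mul_h (N := N) (by omega)
  have hxi := P.x_mem (N := N) (k := i) (by omega) (by omega)
  have hxi2 := P.x_mem (N := N) (k := i + 2) (by omega) (by omega)
  rw [abs_mul, abs_of_nonneg hK0, mul_assoc]
  refine mul_le_mul_of_nonneg_left ?_ hK0
  have := h _ (hl t ht) B (hB t ht) (P.h N) (P.xL + (i + 1 : ℕ) * P.h N) hh
    (by have := hxi.1; rw [x] at this; push_cast; linarith)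
    (by have := hxi2.2; rw [x] at this; push_cast at this ⊢; linarith)
  rwa [q.defect_node hh hN hi] at this

theorem exists_right_consistency {P : DiffusionProblem} {q : QuasiCompact} {m : ℕ}
    (hq : q.HasOrder P.α m P.xL P.xR) (hsymm : q.cm = q.c1) {u : ℝ → ℝ → ℝ}
    (hreg : P.IsRegular m u) :
    ∃ C, 0 ≤ C ∧ ∀ t ∈ Icc 0 P.Tf, ∀ N i : ℕ, i + 2 ≤ N →
      |P.K₂ * (q.cm * rightRL P.xL P.xR P.α (fun y => u y t) (P.x N i)
        + q.c0 * rightRL P.xL P.xR P.α (fun y => u y t) (P.x N (i + 1))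
        + q.c1 * rightRL P.xL P.xR P.α (fun y => u y t) (P.x N (i + 2))
        - (1 / P.h N ^ P.α) * q.conv P.α (fun k => u (P.x N (N - k)) t) (N - (i + 1)))|
        ≤ C * P.h N ^ m := by
  by_cases hK : P.K₂ = 0
  · exact ⟨0, le_rfl, fun t _ N i _ => by simp [hK]⟩
  obtain ⟨hr, B, hB⟩ := hreg.space_right hK
  obtain ⟨C, hC, h⟩ := hq.exists_uniform P.xL_lt_xR P.one_lt_α P.α_le_two
  have hB0 : 0 ≤ B := (abs_nonneg _).trans
    (hB 0 ⟨le_rfl, P.Tf_pos.le⟩ P.xL ⟨le_rfl, P.xL_lt_xR.le⟩)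
  have hK0 := P.K₂_nonneg
  refine ⟨P.K₂ * (C * B), by positivity, fun t ht N i hi => ?_⟩
  have hh : 0 < P.h N := P.h_pos (by omega)
  have hN := P.xL_add_mul_h (N := N) (by omega)
  have hxi := P.x_mem (N := N) (k := i) (by omega) (by omega)
  have hxi2 := P.x_mem (N := N) (k := i + 2) (by omega) (by omega)
  rw [abs_mul, abs_of_nonneg hK0, mul_assoc]
  refine mul_le_mul_of_nonneg_left ?_ hK0
  have := h _ (hr t ht).reflect B
    (fun y hy => (congrArg abs (leftRL_reflect _ _ _ (fun y => u y t) y)).trans_le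
      (hB t ht _ (mapsTo_reflect _ _ hy)))
    (P.h N) (P.xR - (i + 1 : ℕ) * P.h N) hh
    (by have := hxi2.2; rw [x] at this; push_cast at this ⊢; linarith)
    (by have := hxi.1; rw [x] at this; push_cast; linarith)
  rwa [q.defect_node_reflect hsymm hh hN hi (fun y => u y t)] at this

/-- The defect of the exact solution in the scheme that is discrete in space only, at the
interior node `i + 1`. -/
noncomputable def spaceDefect (P : DiffusionProblem) (q : QuasiCompact) (u : ℝ → ℝ → ℝ)
    (N i : ℕ) (t : ℝ) : ℝ :=
  q.cm * (iteratedDerivWithin 1 (u (P.x N i)) (Icc 0 P.Tf) t - P.f (P.x N i) t)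
    + q.c0 * (iteratedDerivWithin 1 (u (P.x N (i + 1))) (Icc 0 P.Tf) t - P.f (P.x N (i + 1)) t)
    + q.c1 * (iteratedDerivWithin 1 (u (P.x N (i + 2))) (Icc 0 P.Tf) t - P.f (P.x N (i + 2)) t)
    - (1 / P.h N ^ P.α) * (P.K₁ * q.conv P.α (fun k => u (P.x N k) t) (i + 1)
        + P.K₂ * q.conv P.α (fun k => u (P.x N (N - k)) t) (N - (i + 1)))

/-- Continuity in `t` is available because the defect is written with `∂_t u - f` in place of the
fractional derivatives, whose continuity in time is not assumed. -/
theorem continuousOn_spaceDefect {P : DiffusionProblem} (q : QuasiCompact) {m : ℕ}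
    {u : ℝ → ℝ → ℝ} (hreg : P.IsRegular m u) {N i : ℕ} (hi : i + 2 ≤ N) :
    ContinuousOn (P.spaceDefect q u N i) (Icc 0 P.Tf) := by
  have hx (k : ℕ) (hk : k ≤ N) := P.x_mem (N := N) (by omega) hk
  have hf (k : ℕ) (hk : k ≤ N) : ContinuousOn (fun t => P.f (P.x N k) t) (Icc 0 P.Tf) := by
    simpa using hreg.time_f.continuousOn_right (j := 0) (Nat.zero_le _) (hx k hk)
  have hu (k : ℕ) (hk : k ≤ N) : ContinuousOn (fun t => u (P.x N k) t) (Icc 0 P.Tf) := by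
    simpa using hreg.time_u.continuousOn_right (j := 0) (Nat.zero_le _) (hx k hk)
  have hd (k : ℕ) (hk : k ≤ N) (c : ℝ) : ContinuousOn (fun t =>
      c * (iteratedDerivWithin 1 (u (P.x N k)) (Icc 0 P.Tf) t - P.f (P.x N k) t)) (Icc 0 P.Tf) :=
    continuousOn_const.mul
      ((hreg.time_u.continuousOn_right (by norm_num) (hx k hk)).sub (hf k hk))
  have hc (V : ℕ → ℝ → ℝ) (j : ℕ) (hV : ∀ k ≤ j + 1, ContinuousOn (V k) (Icc 0 P.Tf)) (c : ℝ) :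
      ContinuousOn (fun t => c * q.conv P.α (fun k => V k t) j) (Icc 0 P.Tf) :=
    continuousOn_const.mul (continuousOn_finsetSum _ fun l _ =>
      continuousOn_const.mul (hV _ (Nat.sub_le _ _)))
  refine (((hd i (by omega) _).add (hd (i + 1) (by omega) _)).add (hd (i + 2) (by omega) _)).sub
    (continuousOn_const.mul ((hc (fun k => u (P.x N k)) (i + 1) (fun k hk => hu k (by omega)) _).add
      (hc (fun k => u (P.x N (N - k))) _ (fun k _ => hu _ (Nat.sub_le _ _)) _)))

/-- At interior times the equation turns the defect into the sum of the left and right consistency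
errors. The equation is not given at `t = 0` and `t = Tf`, so the bound is carried there by
continuity. -/
theorem exists_spaceDefect_bound {P : DiffusionProblem} {q : QuasiCompact} {m : ℕ}
    (hq : q.HasOrder P.α m P.xL P.xR) (hsymm : q.cm = q.c1) {u : ℝ → ℝ → ℝ}
    (hu : P.IsExactSolution u) (hreg : P.IsRegular m u) :
    ∃ C, 0 ≤ C ∧ ∀ N i : ℕ, i + 2 ≤ N → ∀ t ∈ Icc 0 P.Tf,
      |P.spaceDefect q u N i t| ≤ C * P.h N ^ m := by
  obtain ⟨C₁, hC₁, h₁⟩ := exists_left_consistency hq hreg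
  obtain ⟨C₂, hC₂, h₂⟩ := exists_right_consistency hq hsymm hreg
  refine ⟨C₁ + C₂, by positivity, fun N i hi t ht => ?_⟩
  have hcl : closure (Ioo 0 P.Tf) = Icc 0 P.Tf := closure_Ioo P.Tf_pos.ne
  rw [← hcl] at ht
  refine le_on_closure (f := fun t => |P.spaceDefect q u N i t|) (g := fun _ => _)
    (fun t ht => ?_) ?_ continuousOn_const ht
  · have ht' := Ioo_subset_Icc_self ht
    have hx (k : ℕ) (hk : k ≤ N) := hu.pde_closed hreg (P.x_mem (N := N) (by omega) hk) ht
    rw [spaceDefect, hx i (by omega), hx (i + 1) (by omega), hx (i + 2) (by omega), add_mul]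
    refine le_trans (le_of_eq ?_) ((abs_add_le _ _).trans
      (add_le_add (h₁ t ht' N i hi) (h₂ t ht' N i hi)))
    congr 1
    ring
  · rw [hcl]
    exact (continuousOn_spaceDefect q hreg hi).abs

end DiffusionProblem

/-! ### The defect of the fully discrete scheme -/

namespace DiffusionProblem

theorem stiffness_mulVec (P : DiffusionProblem) (q : QuasiCompact) (N M : ℕ)
    (v : Fin (N - 1) → ℝ) (i : Fin (N - 1)) :
    (P.stiffness q N M).mulVec v i = P.τ M / (2 * P.h N ^ P.α) *
      (P.K₁ * (q.matA P.α N).mulVec v i + P.K₂ * (q.matA P.α N).transpose.mulVec v i) := by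
  simp only [stiffness, Matrix.smul_mulVec, Matrix.add_mulVec, Pi.smul_apply, Pi.add_apply,
    smul_eq_mul]

theorem stiffness_dotProduct_nonpos (P : DiffusionProblem) (q : QuasiCompact) {N M : ℕ}
    (hN : 0 < N) (hM : 0 < M) (hA : MatNegDef (q.matA P.α N)) (v : Fin (N - 1) → ℝ) :
    v ⬝ᵥ (P.stiffness q N M).mulVec v ≤ 0 := by
  have hneg : v ⬝ᵥ (q.matA P.α N).mulVec v ≤ 0 := by
    by_cases hv : v = 0
    · simp [hv]
    · exact (hA v hv).le
  have htr : v ⬝ᵥ (q.matA P.α N).transpose.mulVec v = v ⬝ᵥ (q.matA P.α N).mulVec v := by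
    rw [Matrix.mulVec_transpose, dotProduct_comm, ← Matrix.dotProduct_mulVec]
  rw [stiffness, Matrix.smul_mulVec, Matrix.add_mulVec, Matrix.smul_mulVec, Matrix.smul_mulVec,
    dotProduct_smul, dotProduct_add, dotProduct_smul, dotProduct_smul, htr]
  simp only [smul_eq_mul]
  have hτ := P.τ_pos hM
  have hh := P.h_pos hN
  have h1 := P.K₁_nonneg
  have h2 := P.K₂_nonneg
  refine mul_nonpos_of_nonneg_of_nonpos (by positivity) ?_
  exact add_nonpos (mul_nonpos_of_nonneg_of_nonpos h1 hneg)
    (mul_nonpos_of_nonneg_of_nonpos h2 hneg)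

/-- What a grid function `V` leaves in the scheme. -/
noncomputable def schemeDefect (P : DiffusionProblem) (q : QuasiCompact) (N M : ℕ)
    (V : ℕ → ℕ → ℝ) (n : ℕ) : Fin (N - 1) → ℝ :=
  (q.matT N - P.stiffness q N M).mulVec (interior N fun i => V i (n + 1))
    - ((q.matT N + P.stiffness q N M).mulVec (interior N fun i => V i n)
      + P.τ M • P.source q N M n + P.bdry q N M V n)

/-- The boundary vector contains exactly what the truncated matrices miss, so that only complete
stencils and convolutions remain. -/
theorem schemeDefect_apply (P : DiffusionProblem) (q : QuasiCompact) (N M : ℕ)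
    (V : ℕ → ℕ → ℝ) (n : ℕ) (i : Fin (N - 1)) :
    P.schemeDefect q N M V n i
      = q.cm * (V i (n + 1) - V i n) + q.c0 * (V (i + 1) (n + 1) - V (i + 1) n)
        + q.c1 * (V (i + 2) (n + 1) - V (i + 2) n)
        - P.τ M / (2 * P.h N ^ P.α) *
          (P.K₁ * (q.conv P.α (fun k => V k n) (i + 1) + q.conv P.α (fun k => V k (n + 1)) (i + 1))
          + P.K₂ * (q.conv P.α (fun k => V (N - k) n) (N - (i + 1))
            + q.conv P.α (fun k => V (N - k) (n + 1)) (N - (i + 1))))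
        - P.τ M * P.source q N M n i := by
  have T0 := q.matT_mulVec (fun k => V k n) i
  have T1 := q.matT_mulVec (fun k => V k (n + 1)) i
  rw [← q.matA_mulVec P.α (fun k => V k n) i, ← q.matA_mulVec P.α (fun k => V k (n + 1)) i,
    ← q.matA_transpose_mulVec P.α (fun k => V k n) i,
    ← q.matA_transpose_mulVec P.α (fun k => V k (n + 1)) i]
  have hm : q.cm * (V i (n + 1) - V i n) + q.c0 * (V (i + 1) (n + 1) - V (i + 1) n)
      + q.c1 * (V (i + 2) (n + 1) - V (i + 2) n)
      = (q.cm * V i (n + 1) + q.c0 * V (i + 1) (n + 1) + q.c1 * V (i + 2) (n + 1))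
        - (q.cm * V i n + q.c0 * V (i + 1) n + q.c1 * V (i + 2) n) := by ring
  rw [hm, ← T0, ← T1]
  have hK2 : (if (i : ℕ) + 1 = 1 then P.K₂ * q.w P.α 0 else 0)
      = P.K₂ * (if (i : ℕ) + 1 = 1 then q.w P.α 0 else 0) := by rw [mul_ite, mul_zero]
  have hK1 : (if (i : ℕ) + 1 = N - 1 then P.K₁ * q.w P.α 0 else 0)
      = P.K₁ * (if (i : ℕ) + 1 = N - 1 then q.w P.α 0 else 0) := by rw [mul_ite, mul_zero]
  simp only [schemeDefect, Matrix.sub_mulVec, Matrix.add_mulVec, Pi.sub_apply, Pi.add_apply,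
    Pi.smul_apply, smul_eq_mul, stiffness_mulVec, bdry, hK1, hK2]
  ring

theorem IsSchemeSolution.schemeDefect_eq_zero {P : DiffusionProblem} {q : QuasiCompact} {N M : ℕ}
    {U : ℕ → ℕ → ℝ} (hU : P.IsSchemeSolution q N M U) {n : ℕ} (hn : n < M) :
    P.schemeDefect q N M U n = 0 := by
  rw [schemeDefect, hU.step n hn, sub_self]

/-- The error of a solution of the scheme satisfies the scheme without source and boundary
terms, with the defect as the right-hand side. -/
theorem IsSchemeSolution.error_step {P : DiffusionProblem} {q : QuasiCompact} {N M : ℕ}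
    {U V : ℕ → ℕ → ℝ} (hU : P.IsSchemeSolution q N M U) (h0 : ∀ n ≤ M, V 0 n = U 0 n)
    (hN : ∀ n ≤ M, V N n = U N n) {n : ℕ} (hn : n < M) :
    (q.matT N - P.stiffness q N M).mulVec (interior N fun i => V i (n + 1) - U i (n + 1))
      = (q.matT N + P.stiffness q N M).mulVec (interior N fun i => V i n - U i n)
        + P.schemeDefect q N M V n := by
  have hs (k : ℕ) : (interior N fun i => V i k - U i k)
      = (interior N fun i => V i k) - interior N fun i => U i k := rfl
  have hb : P.bdry q N M V n = P.bdry q N M U n := by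
    unfold bdry
    rw [h0 n hn.le, h0 (n + 1) hn, hN n hn.le, hN (n + 1) hn]
  have h := hU.schemeDefect_eq_zero hn
  rw [← sub_zero (P.schemeDefect q N M V n), ← h, schemeDefect, schemeDefect, hb, hs, hs,
    Matrix.mulVec_sub, Matrix.mulVec_sub]
  abel

/-- The defect splits into the stencil `cm, c0, c1` applied to the time errors at three nodes
(trapezoidal error of `u` plus `τ` times the averaging error of `f`), and `τ` times the mean of the
spatial defects at the two time levels. -/
theorem exists_schemeDefect_bound {P : DiffusionProblem} {q : QuasiCompact} {m : ℕ}
    (hq : q.HasOrder P.α m P.xL P.xR) (hsymm : q.cm = q.c1) {u : ℝ → ℝ → ℝ}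
    (hu : P.IsExactSolution u) (hreg : P.IsRegular m u) :
    ∃ C, 0 ≤ C ∧ ∀ N M : ℕ, 0 < M → ∀ n < M, ∀ i,
      |P.schemeDefect q N M (fun k l => u (P.x N k) (P.t M l)) n i|
        ≤ P.τ M * (C * (P.τ M ^ 2 + P.h N ^ m)) := by
  obtain ⟨C, hC, hres⟩ := exists_spaceDefect_bound hq hsymm hu hreg
  obtain ⟨B, hB, hu3⟩ := hreg.time_u.exists_bound (j := 3) le_rfl
  obtain ⟨D, hD, hf2⟩ := hreg.time_f.exists_bound (j := 2) le_rfl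
  refine ⟨(|q.cm| + |q.c0| + |q.c1|) * (B + D) + C, by positivity, fun N M hM n hn i => ?_⟩
  have hi := i.2
  have hτ := P.τ_pos hM
  have hh : 0 < P.h N := P.h_pos (by omega)
  set τ := P.τ M
  set s := P.t M n with hs_def
  set s' := P.t M (n + 1) with hs'_def
  have hs : s ∈ Icc 0 P.Tf := P.t_mem hM hn.le
  have hs' : s' ∈ Icc 0 P.Tf := P.t_mem hM hn
  have hss : s' - s = τ := by rw [hs_def, hs'_def, t, t]; push_cast; ring
  have hx (k : ℕ) (hk : k ≤ N) := P.x_mem (N := N) (by omega) hk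
  have hE (k : ℕ) (hk : k ≤ N) : |u (P.x N k) s' - u (P.x N k) s
      - τ * ((iteratedDerivWithin 1 (u (P.x N k)) (Icc 0 P.Tf) s
        + iteratedDerivWithin 1 (u (P.x N k)) (Icc 0 P.Tf) s') / 2)
      + τ * ((P.f (P.x N k) s + P.f (P.x N k) s') / 2 - P.f (P.x N k) ((s + s') / 2))|
      ≤ τ * ((B + D) * τ ^ 2) := by
    have h1 := trapezoid_bound P.Tf_pos (hreg.time_u.1 _ (hx k hk)) (hu3 _ (hx k hk)) hs hs'
    have h2 := midpoint_average_bound P.Tf_pos (hreg.time_f.1 _ (hx k hk)) (hf2 _ (hx k hk)) hs hs'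
    rw [hss] at h1 h2
    rw [abs_of_pos hτ] at h1
    refine (abs_add_le _ _).trans ?_
    rw [abs_mul τ, abs_of_pos hτ]
    have h3 := mul_le_mul_of_nonneg_left h2 hτ.le
    linarith
  have hR := hres N i (by omega) s hs
  have hR' := hres N i (by omega) s' hs'
  have key : P.schemeDefect q N M (fun k l => u (P.x N k) (P.t M l)) n i
      = q.cm * (u (P.x N i) s' - u (P.x N i) s
          - τ * ((iteratedDerivWithin 1 (u (P.x N i)) (Icc 0 P.Tf) s
            + iteratedDerivWithin 1 (u (P.x N i)) (Icc 0 P.Tf) s') / 2)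
          + τ * ((P.f (P.x N i) s + P.f (P.x N i) s') / 2 - P.f (P.x N i) ((s + s') / 2)))
        + q.c0 * (u (P.x N (i + 1)) s' - u (P.x N (i + 1)) s
          - τ * ((iteratedDerivWithin 1 (u (P.x N (i + 1))) (Icc 0 P.Tf) s
            + iteratedDerivWithin 1 (u (P.x N (i + 1))) (Icc 0 P.Tf) s') / 2)
          + τ * ((P.f (P.x N (i + 1)) s + P.f (P.x N (i + 1)) s') / 2
            - P.f (P.x N (i + 1)) ((s + s') / 2)))
        + q.c1 * (u (P.x N (i + 2)) s' - u (P.x N (i + 2)) s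
          - τ * ((iteratedDerivWithin 1 (u (P.x N (i + 2))) (Icc 0 P.Tf) s
            + iteratedDerivWithin 1 (u (P.x N (i + 2))) (Icc 0 P.Tf) s') / 2)
          + τ * ((P.f (P.x N (i + 2)) s + P.f (P.x N (i + 2)) s') / 2
            - P.f (P.x N (i + 2)) ((s + s') / 2)))
        + τ * ((P.spaceDefect q u N i s + P.spaceDefect q u N i s') / 2) := by
    have hα : P.h N ^ P.α ≠ 0 := (Real.rpow_pos_of_pos hh _).ne'
    rw [schemeDefect_apply]
    simp only [source, spaceDefect]
    rw [← hs_def, ← hs'_def, show P.τ M / (2 * P.h N ^ P.α) = τ / 2 * (1 / P.h N ^ P.α) by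
      field_simp; rfl]
    ring
  have hc (c : ℝ) {y : ℝ} (hy : |y| ≤ τ * ((B + D) * τ ^ 2)) :
      |c * y| ≤ |c| * (τ * ((B + D) * τ ^ 2)) := by
    rw [abs_mul]; exact mul_le_mul_of_nonneg_left hy (abs_nonneg c)
  have hRR : |τ * ((P.spaceDefect q u N i s + P.spaceDefect q u N i s') / 2)|
      ≤ τ * (C * P.h N ^ m) := by
    rw [abs_mul, abs_of_pos hτ, abs_div, abs_two]
    refine mul_le_mul_of_nonneg_left ?_ hτ.le
    have := abs_add_le (P.spaceDefect q u N i s) (P.spaceDefect q u N i s')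
    linarith
  rw [key]
  have hsum := (abs_add_le _ _).trans (add_le_add ((abs_add_le _ _).trans (add_le_add
    ((abs_add_le _ _).trans (add_le_add (hc q.cm (hE i (by omega)))
      (hc q.c0 (hE (i + 1) (by omega))))) (hc q.c1 (hE (i + 2) (by omega))))) hRR)
  refine hsum.trans ?_
  have hhm : 0 ≤ P.h N ^ m := by positivity
  have h1 : 0 ≤ τ * ((|q.cm| + |q.c0| + |q.c1|) * (B + D) * P.h N ^ m) := by positivity
  have h2 : 0 ≤ τ * (C * τ ^ 2) := by positivity
  linarith

end DiffusionProblem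

/-! ### The convergence estimate -/

theorem QuasiCompact.cm_eq_c1_of_isSymm {q : QuasiCompact} (h : (q.matT 3).IsSymm) :
    q.cm = q.c1 := by
  have := h.apply (⟨0, by norm_num⟩ : Fin (3 - 1)) (⟨1, by norm_num⟩ : Fin (3 - 1))
  simpa [QuasiCompact.matT] using this

theorem theorem3p32 (P : DiffusionProblem) (q : QuasiCompact) (m : ℕ) (hm : 1 ≤ m)
    (hq : q.HasOrder P.α m P.xL P.xR)
    (u : ℝ → ℝ → ℝ) (hu : P.IsExactSolution u) (hreg : P.IsRegular m u)
    (hTsymm : ∀ N : ℕ, (q.matT N).IsSymm)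
    (hTpos : ∃ lam : ℝ, 0 < lam ∧ ∀ (N : ℕ) (v : Fin (N - 1) → ℝ),
      lam * (v ⬝ᵥ v) ≤ v ⬝ᵥ (q.matT N).mulVec v) :
    ∃ C : ℝ, ∀ N M : ℕ, 1 ≤ N → 1 ≤ M → MatNegDef (q.matA P.α N) →
      ∀ U : ℕ → ℕ → ℝ, P.IsSchemeSolution q N M U →
        ∀ n : ℕ, 1 ≤ n → n ≤ M →
          P.discreteL2 N (DiffusionProblem.interior N
            (fun i => u (P.x N i) (P.t M n) - U i n)) ≤ C * (P.τ M ^ 2 + P.h N ^ m) := by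
  obtain ⟨lam, hlam, hpos⟩ := hTpos
  obtain ⟨C, hC, hdef⟩ := DiffusionProblem.exists_schemeDefect_bound hq
    (QuasiCompact.cm_eq_c1_of_isSymm (hTsymm 3)) hu hreg
  have hTf := P.Tf_pos
  have hL : 0 < P.xR - P.xL := sub_pos.2 P.xL_lt_xR
  -- `Tf` bounds `n τ`, `C / lam` comes from the defect and the energy estimate, and `√(xR - xL) =
  -- √h √N` from comparing the discrete norm with the maximum norm.
  refine ⟨√(P.xR - P.xL) * (P.Tf * C / lam), fun N M hN hM hA U hU n _ hn => ?_⟩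
  have hτ := P.τ_pos hM
  have hh := P.h_pos hN
  set R := P.τ M ^ 2 + P.h N ^ m
  have hR : 0 ≤ R := by positivity
  set V : ℕ → ℕ → ℝ := fun k l => u (P.x N k) (P.t M l)
  have hV0 (l : ℕ) (hl : l ≤ M) : V 0 l = U 0 l := by
    rw [hU.left l hl, ← hu.left _ (P.t_mem hM hl)]
    simp [V, DiffusionProblem.x]
  have hVN (l : ℕ) (hl : l ≤ M) : V N l = U N l := by
    rw [hU.right l hl, ← hu.right _ (P.t_mem hM hl)]
    simp only [V, DiffusionProblem.x, P.xL_add_mul_h hN]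
  -- Euclidean bound for a vector of `N - 1 ≤ N` entries, each at most `τ C R` in absolute value.
  set r := √(N : ℝ) * (P.τ M * (C * R)) with hr_def
  have hen := crankNicolson_energy (n := N - 1) (M := M) (T := q.matT N)
    (S := P.stiffness q N M) (r := r)
    (e := fun l => DiffusionProblem.interior N fun k => V k l - U k l)
    (ρ := fun l => P.schemeDefect q N M V l)
    hlam (by positivity) (hTsymm N) (hpos N)
    (P.stiffness_dotProduct_nonpos q hN hM hA) ?_
    (fun l hl => hU.error_step hV0 hVN hl) (fun l hl => ?_) n hn
  · have hsum : P.discreteL2 N (DiffusionProblem.interior N fun k => V k n - U k n)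
        = √(P.h N) * √((DiffusionProblem.interior N fun k => V k n - U k n)
          ⬝ᵥ DiffusionProblem.interior N fun k => V k n - U k n) := by
      rw [DiffusionProblem.discreteL2, Real.sqrt_mul hh.le]
      simp only [dotProduct, pow_two]
    rw [hsum]
    have hnτ : (n : ℝ) * P.τ M ≤ P.Tf := (P.t_mem hM hn).2
    have hNh : √(P.h N) * √(N : ℝ) = √(P.xR - P.xL) := by
      rw [← Real.sqrt_mul hh.le, ← P.xL_add_mul_h hN]
      congr 1
      ring
    calc _ ≤ √(P.h N) * (n * r / lam) := mul_le_mul_of_nonneg_left hen (Real.sqrt_nonneg _)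
      _ = √(P.xR - P.xL) * (n * P.τ M * C / lam * R) := by rw [← hNh, hr_def]; ring
      _ ≤ √(P.xR - P.xL) * (P.Tf * C / lam * R) := by gcongr
      _ = _ := by ring
  · funext i
    have hi := i.2
    have ht0 : P.t M 0 = 0 := by simp [DiffusionProblem.t]
    simp only [DiffusionProblem.interior, V, Pi.zero_apply]
    rw [hU.initial _ (by omega) (by omega), ht0, hu.initial _ (P.x_mem hN (by omega)), sub_self]
  · have hsq : P.schemeDefect q N M V l ⬝ᵥ P.schemeDefect q N M V l
        ≤ N * (P.τ M * (C * R)) ^ 2 := by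
      rw [dotProduct]
      refine (Finset.sum_le_card_nsmul _ _ ((P.τ M * (C * R)) ^ 2) fun i _ => ?_).trans ?_
      · rw [← pow_two]
        exact sq_le_sq' (abs_le.1 (hdef N M hM l hl i)).1 (abs_le.1 (hdef N M hM l hl i)).2
      · rw [Finset.card_univ, Fintype.card_fin, nsmul_eq_mul]
        exact mul_le_mul_of_nonneg_right (by exact_mod_cast N.sub_le 1) (sq_nonneg _)
    refine (Real.sqrt_le_sqrt hsq).trans_eq ?_
    rw [Real.sqrt_mul (Nat.cast_nonneg N), Real.sqrt_sq (by positivity)]
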